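/- Let $\Sigma=\Sigma_{call}\cup\Sigma_{int}\cup\Sigma_{ret}$ be a visibly pushdown alphabet, $\Sigma^\triangle$ its set of well-matched words, $\Delta(w)=|w|_{\Sigma_{call}}-|w|_{\Sigma_{ret}}$, and let $\mathsf{Con}(\Sigma)$ be the set of contexts, i.e. of pairs $(u,v)$ of words with $uv\in\Sigma^\triangle$. For a context $(u,v)$ let $\mathrm{ext}_{u,v}:\Sigma^\triangle\to\Sigma^\triangle$, $x\mapsto uxv$, and let $\mathcal O(\Sigma^\triangle)$ be the monoid of all these maps. A visibly pushdown language (VPL) is the language $L=L(A)\subseteq\Sigma^\triangle$ of a deterministic visibly pushdown automaton (DVPA) $A$. The syntactic congruence of $L$ is the relation $x\sim_L y \iff \forall f\in\mathcal O(\Sigma^\triangle):(f(x)\in L\Leftrightarrow f(y)\in L)$ on $\Sigma^\triangle$. Let $R_L=\Sigma^\triangle/{\sim_L}$, let $\varphi_L:\Sigma^\triangle\to R_L$ be the projection, let $\psi_L(f):R_L\to R_L$ be the map $[x]\mapsto[f(x)]$ for $f\in\mathcal O(\Sigma^\triangle)$, and let $O_L=\psi_L(\mathcal O(\Sigma^\triangle))$,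 a monoid under composition. An element $r\in R_L$ is reachable if $f(r)\in\varphi_L(L)$ for some $f\in O_L$, and $e\in O_L$ is reachable if $e(r)$ is reachable for some $r\in R_L$. For $e\in O_L$ put $\mathcal R_e=\{(u,v)\in\mathsf{Con}(\Sigma)\mid\psi_L(\mathrm{ext}_{u,v})=e\}$. The language $L$ is * length-synchronous if for every reachable idempotent $e\in O_L$ and all $(u,v),(u',v')\in\mathcal R_e$ with $\Delta(u),\Delta(u')>0$ we have $|u|/|v|=|u'|/|v'|$; * weakly length-synchronous if for every reachable idempotent $e\in O_L$ and all $(u,v),(u',v')\in\mathcal R_e$ with $\Delta(u),\Delta(u')>0$, $u=u'$ implies $|v|=|v'|$ and $v=v'$ implies $|u|=|u'|$. For $k,l\in\mathbb N_{>0}$ let $\mathcal L_{k,l}$ be the language generated by the context-free grammar $S\to ac^{k-1}Sb_1\mid ac^{l-1}Sb_2\mid\varepsilon$. For languages $K,L$ over finite alphabets, encoded over $\{0,1\}$ by replacing each letter by a block of bits of fixed size, write $K\le_{\mathrm{cd}}L$ (constant-depth truth-table reducibility) if there are a polynomial $p$, a constant $d$ and a (possibly non-uniform) family of circuits $(C_n)_{n\in\mathbb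 N}$ deciding $K$, where $C_n$ has $n$ inputs, depth at most $d$, size at most $p(n)$, and is built from NOT gates, unbounded fan-in AND and OR gates, and oracle gates for $L$ with at most $p(n)$ inputs, with no path from the output of an oracle gate to an input of an oracle gate. **Proposition.** If a VPL $L$ is weakly length-synchronous but not length-synchronous, one can effectively compute $k,l\in\mathbb N_{>0}$ with $k\ne l$ such that $\mathcal L_{k,l}\le_{\mathrm{cd}}L$. That is, there is a partial computable function which, on every DVPA $A$ whose language $L(A)$ is weakly length-synchronous but not length-synchronous, halts and outputs such a pair $(k,l)$ for $L=L(A)$. -/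

import Mathlib

/-! ### Visibly pushdown alphabets, well-matched words, contexts -/

namespace VP

/-- The three kinds of letters of a visibly pushdown alphabet. -/
inductive LetterKind where
  | call
  | int
  | ret
deriving DecidableEq

/-- The set `Σ^△` of well-matched words. A visibly pushdown alphabet is given by a type `α` of
letters and the map `kind` telling which letters are call, internal and return letters. -/
inductive WellMatched {α : Type*} (kind : α → LetterKind) : List α → Prop
  | nil : WellMatched kind []
  | int {c : α} : kind c = .int → WellMatched kind [c]
  | wrap {a b : α} {w : List α} : kind a = .call → kind b = .ret → WellMatched kind w →
      WellMatched kind (a :: (w ++ [b]))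
  | append {u v : List α} : u ≠ [] → v ≠ [] → WellMatched kind u → WellMatched kind v →
      WellMatched kind (u ++ v)

/-- The height morphism `Δ`: number of call letters minus number of return letters. -/
def height {α : Type*} (kind : α → LetterKind) (w : List α) : ℤ :=
  (w.countP (fun a => kind a = .call) : ℤ) - (w.countP (fun a => kind a = .ret) : ℤ)

theorem WellMatched.append' {α : Type*} {kind : α → LetterKind} {u v : List α}
    (hu : WellMatched kind u) (hv : WellMatched kind v) : WellMatched kind (u ++ v) := by
  by_cases h : u = []
  · simpa [h] using hv
  by_cases h' : v = []
  · simpa [h'] using hu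
  exact .append h h' hu hv

theorem WellMatched.insert {α : Type*} {kind : α → LetterKind} {x : List α}
    (hx : WellMatched kind x) {w : List α} (hw : WellMatched kind w) :
    ∀ u v : List α, w = u ++ v → WellMatched kind (u ++ x ++ v) := by
  induction hw with
  | nil =>
    intro u v h
    obtain ⟨rfl, rfl⟩ := List.append_eq_nil_iff.1 h.symm
    simpa using hx
  | @int c hc =>
    intro u v h
    rcases List.append_eq_singleton_iff.1 h.symm with ⟨rfl, rfl⟩ | ⟨rfl, rfl⟩
    · simpa using hx.append' (.int hc)
    · simpa using WellMatched.append' (.int hc) hx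
  | @wrap a b w ha hb hw ih =>
    intro u v h
    rcases u with _ | ⟨a', u⟩
    · have h' : v = a :: (w ++ [b]) := by simpa using h.symm
      subst h'
      simpa using hx.append' (.wrap ha hb hw)
    · rcases List.eq_nil_or_concat v with rfl | ⟨v', b', rfl⟩
      · have h' : a' :: u = a :: (w ++ [b]) := by simpa using h.symm
        rw [h', List.append_nil]
        exact WellMatched.append' (.wrap ha hb hw) hx
      · have h1 : a = a' ∧ w ++ [b] = (u ++ v') ++ [b'] := by simpa using h
        obtain ⟨rfl, h2⟩ := h1
        obtain ⟨h3, h4⟩ := List.append_inj' h2 rfl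
        obtain rfl : b = b' := by simpa using h4
        have := WellMatched.wrap ha hb (ih u v' h3)
        simpa using this
  | @append u₁ v₁ _ _ h₁ h₂ ih₁ ih₂ =>
    intro u v h
    rcases List.append_eq_append_iff.1 h with ⟨t, rfl, rfl⟩ | ⟨t, rfl, rfl⟩
    · have := h₁.append' (ih₂ t v rfl)
      simpa using this
    · have := (ih₁ u t rfl).append' h₂
      simpa using this

/-- The monoid `Σ^△` of well-matched words under concatenation. -/
def WMWord {α : Type*} (kind : α → LetterKind) : Type _ := {w : List α // WellMatched kind w}

instance {α : Type*} (kind : α → LetterKind) : Monoid (WMWord kind) where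
  one := ⟨[], .nil⟩
  mul u v := ⟨u.1 ++ v.1, u.2.append' v.2⟩
  mul_assoc u v w := Subtype.ext (List.append_assoc u.1 v.1 w.1)
  one_mul u := Subtype.ext (List.nil_append u.1)
  mul_one u := Subtype.ext (List.append_nil u.1)

/-- A context is a pair `(u, v)` of words such that `uv` is well-matched. -/
def IsContext {α : Type*} (kind : α → LetterKind) (σ : List α × List α) : Prop :=
  WellMatched kind (σ.1 ++ σ.2)

/-- The type `Con(Σ)` of contexts. -/
def Context {α : Type*} (kind : α → LetterKind) : Type _ := {σ : List α × List α // IsContext kind σ}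

/-- A set of contexts is length-synchronous if `|u|/|v| = |u'|/|v'|` for all of its elements
`(u, v)`, `(u', v')` with `Δ(u), Δ(u') > 0`. -/
def LengthSynchronous {α : Type*} {kind : α → LetterKind} (R : Set (Context kind)) : Prop :=
  ∀ σ ∈ R, ∀ τ ∈ R, 0 < height kind σ.1.1 → 0 < height kind τ.1.1 →
    (σ.1.1.length : ℚ) / (σ.1.2.length : ℚ) = (τ.1.1.length : ℚ) / (τ.1.2.length : ℚ)

/-- A set of contexts is weakly length-synchronous if for all of its elements `(u, v)`, `(u', v')`
with `Δ(u), Δ(u') > 0`, `u = u'` implies `|v| = |v'|` and `v = v'` implies `|u| = |u'|`. -/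
def WeaklyLengthSynchronous {α : Type*} {kind : α → LetterKind} (R : Set (Context kind)) : Prop :=
  ∀ σ ∈ R, ∀ τ ∈ R, 0 < height kind σ.1.1 → 0 < height kind τ.1.1 →
    (σ.1.1 = τ.1.1 → σ.1.2.length = τ.1.2.length) ∧
    (σ.1.2 = τ.1.2 → σ.1.1.length = τ.1.1.length)

/-- The function `ext_{u,v} : x ↦ u x v` on well-matched words, for a context `(u, v)`. -/
def ext {α : Type*} {kind : α → LetterKind} (σ : Context kind) : Function.End (WMWord kind) :=
  fun x => ⟨σ.1.1 ++ x.1 ++ σ.1.2, x.2.insert σ.2 _ _ rfl⟩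

/-! ### Ext-algebras -/

/-- An Ext-algebra `(R, O)`: a monoid `R` together with a submonoid `O` of `R^R` containing all
left and right multiplications. -/
structure ExtAlgebra (R : Type*) [Monoid R] where
  ops : Submonoid (Function.End R)
  left_mem : ∀ r : R, (fun x => r * x : Function.End R) ∈ ops
  right_mem : ∀ r : R, (fun x => x * r : Function.End R) ∈ ops

/-- Morphisms of Ext-algebras. -/
structure ExtHom {R S : Type*} [Monoid R] [Monoid S] (A : ExtAlgebra R) (B : ExtAlgebra S) where
  φ : R →* S
  ψ : A.ops →* B.ops
  map_apply : ∀ (e : A.ops) (r : R), (ψ e).1 (φ r) = φ (e.1 r)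
  map_left : ∀ r : R, ψ ⟨_, A.left_mem r⟩ = ⟨_, B.left_mem (φ r)⟩
  map_right : ∀ r : R, ψ ⟨_, A.right_mem r⟩ = ⟨_, B.right_mem (φ r)⟩

/-- The Ext-algebra `(Σ^△, O(Σ^△))`, where `O(Σ^△)` is the set of all `ext_{u,v}`. -/
def freeExt {α : Type*} (kind : α → LetterKind) : ExtAlgebra (WMWord kind) where
  ops :=
    { carrier := Set.range (ext (kind := kind))
      one_mem' := ⟨⟨([], []), .nil⟩, by
        funext x; apply Subtype.ext; simp [ext]; rfl⟩
      mul_mem' := by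
        rintro _ _ ⟨σ, rfl⟩ ⟨τ, rfl⟩
        refine ⟨⟨(σ.1.1 ++ τ.1.1, τ.1.2 ++ σ.1.2), ?_⟩, ?_⟩
        · have := WellMatched.insert τ.2 σ.2 _ _ rfl
          simpa [IsContext] using this
        · funext x
          apply Subtype.ext
          change _ = σ.1.1 ++ (τ.1.1 ++ x.1 ++ τ.1.2) ++ σ.1.2
          simp [ext] }
  left_mem r := ⟨⟨(r.1, []), by simpa [IsContext] using r.2⟩, by
    funext x; apply Subtype.ext; simp [ext]; rfl⟩
  right_mem r := ⟨⟨([], r.1), by simpa [IsContext] using r.2⟩, by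
    funext x; apply Subtype.ext; simp [ext]; rfl⟩

/-- `ext_{u,v}` as an element of `O(Σ^△)`. -/
def extOp {α : Type*} {kind : α → LetterKind} (σ : Context kind) : (freeExt kind).ops :=
  ⟨ext σ, σ, rfl⟩

/-- A congruence on `(R, O)`: an equivalence relation on `R` preserved by every `e ∈ O`. -/
structure ExtCongruence {R : Type*} [Monoid R] (A : ExtAlgebra R) extends Setoid R where
  op_rel : ∀ e ∈ A.ops, ∀ x y : R, r x y → r (e x) (e y)

/-- The underlying monoid congruence. -/
def ExtCongruence.con {R : Type*} [Monoid R] {A : ExtAlgebra R} (c : ExtCongruence A) : Con R where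
  toSetoid := c.toSetoid
  mul' {w x y z} h₁ h₂ :=
    c.iseqv.trans (c.op_rel _ (A.right_mem y) w x h₁) (c.op_rel _ (A.left_mem x) y z h₂)

/-- The quotient `(R, O)/∼`. -/
def ExtCongruence.quotient {R : Type*} [Monoid R] {A : ExtAlgebra R} (c : ExtCongruence A) :
    ExtAlgebra c.con.Quotient where
  ops :=
    { carrier := {e' | ∃ e ∈ A.ops, ∀ x : R, e' (x : c.con.Quotient) = ((e x : R) : c.con.Quotient)}
      one_mem' := ⟨1, A.ops.one_mem, fun _ => rfl⟩
      mul_mem' := by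
        rintro f' g' ⟨f, hf, hf'⟩ ⟨g, hg, hg'⟩
        refine ⟨f * g, A.ops.mul_mem hf hg, fun x => ?_⟩
        change f' (g' x) = ((f (g x) : R) : c.con.Quotient)
        rw [hg', hf'] }
  left_mem r := by
    induction r using Con.induction_on with
    | H r => exact ⟨_, A.left_mem r, fun _ => rfl⟩
  right_mem r := by
    induction r using Con.induction_on with
    | H r => exact ⟨_, A.right_mem r, fun _ => rfl⟩

/-- The morphism associated to a congruence: `φ(r) = [r]` and `ψ(e)([r]) = [e(r)]`. -/
def ExtCongruence.hom {R : Type*} [Monoid R] {A : ExtAlgebra R} (c : ExtCongruence A) :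
    ExtHom A c.quotient where
  φ := c.con.mk'
  ψ :=
    { toFun := fun e => ⟨fun q => Quotient.map e.1 (fun x y h => c.op_rel e.1 e.2 x y h) q,
        e.1, e.2, fun _ => rfl⟩
      map_one' := by
        apply Subtype.ext; funext q
        induction q using Con.induction_on with
        | H r => rfl
      map_mul' := fun e f => by
        apply Subtype.ext; funext q
        induction q using Con.induction_on with
        | H r => rfl }
  map_apply _ _ := rfl
  map_left r := by
    apply Subtype.ext; funext q
    induction q using Con.induction_on with
    | H x => rfl
  map_right r := by
    apply Subtype.ext; funext q
    induction q using Con.induction_on with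
    | H x => rfl

/-- `r ∈ R` is `F`-reachable if `e(r) ∈ F` for some `e ∈ O`. -/
def ExtAlgebra.ReachableElem {R : Type*} [Monoid R] (A : ExtAlgebra R) (F : Set R) (r : R) : Prop :=
  ∃ e : A.ops, e.1 r ∈ F

/-- `e ∈ O` is `F`-reachable if `e(r)` is `F`-reachable for some `r ∈ R`. -/
def ExtAlgebra.ReachableOp {R : Type*} [Monoid R] (A : ExtAlgebra R) (F : Set R) (e : A.ops) :
    Prop :=
  ∃ r : R, A.ReachableElem F (e.1 r)

/-- The set of contexts `R_e = {(u, v) | ψ(ext_{u,v}) = e}`. -/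
def ExtHom.contextsOver {α : Type*} {kind : α → LetterKind} {R : Type*} [Monoid R]
    {A : ExtAlgebra R} (h : ExtHom (freeExt kind) A) (e : A.ops) : Set (Context kind) :=
  {σ | h.ψ (extOp σ) = e}

/-- `F`-length-synchronicity of a morphism. -/
def ExtHom.IsLengthSync {α : Type*} {kind : α → LetterKind} {R : Type*} [Monoid R]
    {A : ExtAlgebra R} (h : ExtHom (freeExt kind) A) (F : Set R) : Prop :=
  ∀ e : A.ops, IsIdempotentElem e → A.ReachableOp F e → LengthSynchronous (h.contextsOver e)

/-- `F`-weak-length-synchronicity of a morphism. -/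
def ExtHom.IsWeaklyLengthSync {α : Type*} {kind : α → LetterKind} {R : Type*} [Monoid R]
    {A : ExtAlgebra R} (h : ExtHom (freeExt kind) A) (F : Set R) : Prop :=
  ∀ e : A.ops, IsIdempotentElem e → A.ReachableOp F e → WeaklyLengthSynchronous (h.contextsOver e)

/-- The syntactic congruence of a language of well-matched words:
`u ∼ v` iff `e(u) ∈ L ↔ e(v) ∈ L` for all `e ∈ O(Σ^△)`. -/
def synCongruence {α : Type*} (kind : α → LetterKind) (L : Language α) :
    ExtCongruence (freeExt kind) where
  r u v := ∀ e : (freeExt kind).ops, (e.1 u).1 ∈ L ↔ (e.1 v).1 ∈ L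
  iseqv := ⟨fun _ _ => Iff.rfl, fun h e => (h e).symm, fun h h' e => (h e).trans (h' e)⟩
  op_rel f hf _ _ h e := h (⟨e.1 * f, (freeExt kind).ops.mul_mem e.2 hf⟩)

/-- The image `φ_L(L)` of `L` in its syntactic Ext-algebra. -/
def synImage {α : Type*} (kind : α → LetterKind) (L : Language α) :
    Set (synCongruence kind L).con.Quotient :=
  (synCongruence kind L).hom.φ '' {w : WMWord kind | w.1 ∈ L}

/-- A language of well-matched words is length-synchronous if its syntactic morphism is
`φ_L(L)`-length-synchronous. -/
def IsLengthSynchronous {α : Type*} (kind : α → LetterKind) (L : Language α) : Prop :=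
  (synCongruence kind L).hom.IsLengthSync (synImage kind L)

/-- A language of well-matched words is weakly length-synchronous if its syntactic morphism is
`φ_L(L)`-weakly-length-synchronous. -/
def IsWeaklyLengthSynchronous {α : Type*} (kind : α → LetterKind) (L : Language α) : Prop :=
  (synCongruence kind L).hom.IsWeaklyLengthSync (synImage kind L)

/-! ### Deterministic visibly pushdown automata -/

/-- A deterministic visibly pushdown automaton with states `Q` and stack alphabet `Γ`; stacks are
lists whose head is the top. -/
structure DVPA {α : Type*} (kind : α → LetterKind) (Q Γ : Type*) where
  δ : Q → α → Γ → Q × List Γ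
  start : Q
  final : Finset Q
  bot : Γ
  δ_call : ∀ q a γ, kind a = .call → ∃ β, β ≠ bot ∧ (δ q a γ).2 = [β, γ]
  δ_ret : ∀ q a γ, kind a = .ret → (δ q a γ).2 = []
  δ_int : ∀ q a γ, kind a = .int → (δ q a γ).2 = [γ]

/-- The extended transition function. -/
def DVPA.run {α : Type*} {kind : α → LetterKind} {Q Γ : Type*} (A : DVPA kind Q Γ) :
    Q → List α → List Γ → Q × List Γ
  | q, [], β => (q, β)
  | q, _ :: _, [] => (q, [])
  | q, a :: w, γ :: β => A.run (A.δ q a γ).1 w ((A.δ q a γ).2 ++ β)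

/-- The language of a DVPA: acceptance by final state with stack `⊥`. -/
def DVPA.language {α : Type*} {kind : α → LetterKind} {Q Γ : Type*} (A : DVPA kind Q Γ) :
    Language α :=
  {w | (A.run A.start w [A.bot]).1 ∈ A.final ∧ (A.run A.start w [A.bot]).2 = [A.bot]}

/-- A number for each kind of letter. -/
def kindCode : LetterKind → ℕ
  | .call => 0
  | .int => 1
  | .ret => 2

/-- Finite descriptions of DVPAs, the inputs of algorithms: numbers of letters, states and stack
symbols; the kinds of the letters; start state; the indicator list of the final states; bottom
symbol; the table of the transition function. -/
abbrev DVPACode : Type :=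
  (ℕ × ℕ × ℕ) × List ℕ × ℕ × List ℕ × ℕ × List (List (List (ℕ × List ℕ)))

/-- The description of a DVPA whose letters, states and stack symbols are initial segments
of the natural numbers. -/
def DVPA.code {s n g : ℕ} {kind : Fin s → LetterKind} (A : DVPA kind (Fin n) (Fin g)) : DVPACode :=
  ((s, n, g),
    List.ofFn fun a => kindCode (kind a),
    A.start.1,
    List.ofFn fun q => if q ∈ A.final then 1 else 0,
    A.bot.1,
    List.ofFn fun q => List.ofFn fun a => List.ofFn fun γ =>
      ((A.δ q a γ).1.1, (A.δ q a γ).2.map fun β => β.1))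

/-! ### The languages `𝓛_{k,l}` -/

/-- The alphabet of the languages `𝓛_{k,l}`. -/
inductive ABC where
  | a
  | c
  | b₁
  | b₂
deriving DecidableEq

instance : Finite ABC :=
  Finite.of_injective (fun x => match x with | .a => 0 | .c => 1 | .b₁ => 2 | .b₂ => 3 : ABC → Fin 4)
    (by intro x y; cases x <;> cases y <;> simp)

/-- The productions `S → a c^{k-1} S b₁ | a c^{l-1} S b₂ | ε`. -/
def rulesKL (k l : ℕ) : Finset (ContextFreeRule ABC Unit) :=
  { ⟨(), .terminal .a :: (List.replicate (k - 1) (.terminal .c) ++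
        [.nonterminal (), .terminal .b₁])⟩,
    ⟨(), .terminal .a :: (List.replicate (l - 1) (.terminal .c) ++
        [.nonterminal (), .terminal .b₂])⟩,
    ⟨(), []⟩ }

/-- The grammar with these productions. -/
def grammarKL (k l : ℕ) : ContextFreeGrammar ABC where
  NT := Unit
  initial := ()
  rules := rulesKL k l

/-- The language `𝓛_{k,l}`. -/
def langKL (k l : ℕ) : Language ABC := (grammarKL k l).language

/-! ### Constant-depth truth-table reducibility -/

/-- Gates with `n` circuit inputs, fed by earlier gates `0, …, i - 1`. An oracle gate has an
ordered list of bits as input. -/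
inductive Gate (n i : ℕ) where
  | input (j : Fin n)
  | not (j : Fin i)
  | and (js : List (Fin i))
  | or (js : List (Fin i))
  | oracle (js : List (Fin i))

/-- The gates feeding a gate. -/
def Gate.args {n i : ℕ} : Gate n i → List (Fin i)
  | .input _ => []
  | .not j => [j]
  | .and js => js
  | .or js => js
  | .oracle js => js

/-- Being an oracle gate. -/
def Gate.IsOracle {n i : ℕ} : Gate n i → Prop
  | .oracle _ => True
  | _ => False

/-- Boolean circuits with unbounded fan-in and oracle gates: directed acyclic graphs, listed in a
topological order, with a distinguished output gate. -/
structure Circuit (n : ℕ) where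
  size : ℕ
  gate : (i : Fin size) → Gate n i.1
  output : Fin size

open Classical in
/-- The value of a gate, for the oracle `B` and the input bits `x`. -/
noncomputable def Circuit.eval {n : ℕ} (C : Circuit n) (B : Language Bool) (x : Fin n → Bool)
    (i : Fin C.size) : Bool :=
  match C.gate i with
  | .input j => x j
  | .not j => !(C.eval B x ⟨j.1, j.2.trans i.2⟩)
  | .and js => (js.map fun j => C.eval B x ⟨j.1, j.2.trans i.2⟩).all id
  | .or js => (js.map fun j => C.eval B x ⟨j.1, j.2.trans i.2⟩).any id
  | .oracle js => decide ((js.map fun j => C.eval B x ⟨j.1, j.2.trans i.2⟩) ∈ B)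
termination_by i.1

/-- The length of a longest path from a source to the gate `i`. -/
def Circuit.depthAt {n : ℕ} (C : Circuit n) (i : Fin C.size) : ℕ :=
  ((C.gate i).args.map fun j => C.depthAt ⟨j.1, j.2.trans i.2⟩ + 1).foldr max 0
termination_by i.1

/-- `C.Wire j i`: the output of gate `j` is an input of gate `i`. -/
def Circuit.Wire {n : ℕ} (C : Circuit n) (j i : Fin C.size) : Prop :=
  ∃ h : j.1 < i.1, (⟨j.1, h⟩ : Fin i.1) ∈ (C.gate i).args

/-- Constant-depth truth-table reducibility of binary languages: there are a polynomial `p`, a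
constant `d` and circuits `C n` with `n` inputs deciding `K`, using oracle gates for `L`, of depth
at most `d` and size at most `p n`, whose oracle gates have at most `p n` inputs, and without paths
from an oracle gate to an oracle gate. -/
def BinCDReducible (K L : Language Bool) : Prop :=
  ∃ (p : Polynomial ℕ) (d : ℕ) (C : (n : ℕ) → Circuit n), ∀ n : ℕ,
    (∀ x : Fin n → Bool, (C n).eval L x (C n).output = true ↔ List.ofFn x ∈ K) ∧
    (∀ i, (C n).depthAt i ≤ d) ∧
    (C n).size ≤ p.eval n ∧
    (∀ i, ((C n).gate i).IsOracle → ((C n).gate i).args.length ≤ p.eval n) ∧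
    (∀ i j, ((C n).gate i).IsOracle → ((C n).gate j).IsOracle →
      ¬ Relation.TransGen (C n).Wire i j)

/-- A binary encoding of an alphabet by blocks of a fixed positive length. -/
structure BlockCode (α : Type*) where
  size : ℕ
  size_pos : 0 < size
  block : α → List.Vector Bool size
  injective : Function.Injective block

/-- The binary language encoding a language over an arbitrary alphabet. -/
def BlockCode.encode {α : Type*} (E : BlockCode α) (L : Language α) : Language Bool :=
  {x | ∃ w ∈ L, x = w.flatMap fun a => (E.block a).toList}

/-- `K ≤_cd L`: constant-depth truth-table reducibility of the binary encodings of two languages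
over finite alphabets. The choice of the encodings is immaterial; the definition asks for a
reduction for each of them. -/
def CDReducible {α β : Type*} [Finite α] [Finite β] (K : Language α) (L : Language β) : Prop :=
  ∀ (E : BlockCode α) (E' : BlockCode β), BinCDReducible (E.encode K) (E'.encode L)

end VP

/-! Failure of length-synchronicity gives a reachable idempotent `e` of `O_L` with two contexts over
it whose slopes |u|/|v| differ. Powers equalise their heights, and a sandwich between further
contexts over `e` turns them into two blocks (u₀,v₀), (u₁,v₁) over `e` such that every mixture
(uᵢ,vⱼ) is again a context and its class F satisfies e F = F = F e (`exists_blockPair`).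

Let i ≠ j. If F R = e for some R, finiteness of `O_L` yields Fⁿ = e for some n > 0
(`exists_pow_eq_of_mul_eq`). Weak length-synchronicity, applied to (uᵢⁿ,vⱼⁿ) and the two unmixed
powers, then gives |u₀| = |u₁| and |v₀| = |v₁|, which contradicts the different slopes
(`BlockPair.pow_ne`). Peeling off blocks from outside, a context with the left parts of a sequence I
and the right parts of a sequence J can have class `e`, up to a factor `e`, only if I = J
(`BlockPair.eq_of_synOp_eq`). Class `e` is recognised by finitely many membership tests
(`exists_tests`), so `L` can be asked whether two sequences coincide. That is the only non-local
condition for membership in 𝓛_{k,l}.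

To put the questions in constant depth, each letter has to be replaced by a number of letters that
does not depend on its surroundings. Products of blocks achieve left lengths in the ratio N : N+1
with equal right lengths, for every sufficiently large N (`exists_block_tests`). In a word of
𝓛_{N,N+1} the block around a position is visible in a window of constant width, so a disjunction
over the boundary between the two halves, local checks and one layer of oracle gates suffice
(`cdReducible_of_block_tests`).

Since N only has to be large, it can be computed from a size bound: a failure of
length-synchronicity already occurs among contexts whose length is bounded in terms of the numbers
of states and stack symbols (`exists_short_witnesses`). This uses weak length-synchronicity once
more, to shorten contexts without losing control of their lengths. -/

namespace VP

/-! ### Stack depths -/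

section Words

variable {α : Type*} {kind : α → LetterKind}

/-- The effect of a letter on the number of pending calls. -/
def LetterKind.step : LetterKind → ℕ → Option ℕ
  | .call, d => some (d + 1)
  | .int, d => some d
  | .ret, 0 => none
  | .ret, d + 1 => some d

/-- The number of pending calls after reading a word, started with `d` pending calls;
undefined if some return letter finds no pending call. -/
def depth (kind : α → LetterKind) : ℕ → List α → Option ℕ
  | d, [] => some d
  | d, a :: w => ((kind a).step d).bind fun d' => depth kind d' w

theorem depth_append (d : ℕ) (u v : List α) :
    depth kind d (u ++ v) = (depth kind d u).bind fun d' => depth kind d' v := by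
  induction u generalizing d with
  | nil => rfl
  | cons a u ih =>
    simp only [List.cons_append, depth, Option.bind_assoc]
    congr 1
    funext d'
    exact ih d'

theorem depth_append_of_eq {d d' : ℕ} {u : List α} (h : depth kind d u = some d') (v : List α) :
    depth kind d (u ++ v) = depth kind d' v := by
  rw [depth_append, h, Option.bind_some]

theorem exists_depth_of_append {d d' : ℕ} {u v : List α} (h : depth kind d (u ++ v) = some d') :
    ∃ c, depth kind d u = some c ∧ depth kind c v = some d' := by
  rw [depth_append] at h
  exact Option.bind_eq_some_iff.1 h

theorem height_append (u v : List α) :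
    height kind (u ++ v) = height kind u + height kind v := by
  simp only [height, List.countP_append]
  push_cast
  ring

theorem height_nil : height kind [] = 0 := by simp [height]

theorem eq_add_height_of_depth {d d' : ℕ} {w : List α} (h : depth kind d w = some d') :
    (d' : ℤ) = d + height kind w := by
  induction w generalizing d with
  | nil =>
    obtain rfl : d = d' := by simpa [depth] using h
    simp [height]
  | cons a w ih =>
    obtain ⟨c, hc, hw⟩ := Option.bind_eq_some_iff.1 h
    have h1 := ih hw
    have h2 : height kind (a :: w) = height kind [a] + height kind w := height_append [a] w
    have h3 : (c : ℤ) = d + height kind [a] := by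
      cases hk : kind a with
      | call => simp [hk, LetterKind.step] at hc; simp [height, hk, ← hc]
      | int => simp [hk, LetterKind.step] at hc; simp [height, hk, ← hc]
      | ret =>
        cases d with
        | zero => simp [hk, LetterKind.step] at hc
        | succ d => simp [hk, LetterKind.step] at hc; simp [height, hk, ← hc]
    rw [h1, h2, h3]
    ring

theorem WellMatched.depth_eq {w : List α} (hw : WellMatched kind w) (d : ℕ) :
    depth kind d w = some d := by
  induction hw generalizing d with
  | nil => rfl
  | int hc => simp [depth, hc, LetterKind.step]
  | wrap ha hb _ ih =>
    simp [depth, ha, LetterKind.step, depth_append, ih, hb]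
  | append _ _ _ _ ih₁ ih₂ => rw [depth_append_of_eq (ih₁ d), ih₂]

/-- A word reading which decreases the number of pending calls from `d` to `0` begins with a
well-matched word and, if `d ≠ 0`, a return letter. -/
def ReturnForm (kind : α → LetterKind) : ℕ → List α → Prop
  | 0, w => WellMatched kind w
  | d + 1, w => ∃ x b w', w = x ++ b :: w' ∧ WellMatched kind x ∧ kind b = .ret ∧
      ReturnForm kind d w'

theorem ReturnForm.append_left {d : ℕ} {w z : List α} (hz : WellMatched kind z)
    (hw : ReturnForm kind d w) : ReturnForm kind d (z ++ w) := by
  cases d with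
  | zero => exact hz.append' hw
  | succ d =>
    obtain ⟨x, b, w', rfl, hx, hb, hw'⟩ := hw
    exact ⟨z ++ x, b, w', by simp, hz.append' hx, hb, hw'⟩

/-- Induction on the word. After a call, the form of the remaining word supplies the matching
return, and the call, the return and what lies between them join the initial well-matched factor. -/
theorem returnForm_of_depth {d : ℕ} {w : List α} (h : depth kind d w = some 0) :
    ReturnForm kind d w := by
  induction w generalizing d with
  | nil =>
    obtain rfl : d = 0 := by simpa [depth] using h
    exact .nil
  | cons a w ih =>
    obtain ⟨c, hc, hw⟩ := Option.bind_eq_some_iff.1 h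
    have h1 := ih hw
    cases hk : kind a with
    | call =>
      obtain rfl : d + 1 = c := by simpa [hk, LetterKind.step] using hc
      obtain ⟨x, b, w', rfl, hx, hb, hw'⟩ := h1
      simpa using ReturnForm.append_left (.wrap hk hb hx) hw'
    | int =>
      obtain rfl : d = c := by simpa [hk, LetterKind.step] using hc
      exact ReturnForm.append_left (.int hk) h1
    | ret =>
      cases d with
      | zero => simp [hk, LetterKind.step] at hc
      | succ d =>
        obtain rfl : d = c := by simpa [hk, LetterKind.step] using hc
        exact ⟨[], a, w, rfl, .nil, hk, h1⟩

theorem wellMatched_iff_depth {w : List α} : WellMatched kind w ↔ depth kind 0 w = some 0 :=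
  ⟨fun h => h.depth_eq 0, fun h => returnForm_of_depth h⟩

/-- Decomposition of a word at its last pending call. -/
theorem exists_last_call {h : ℕ} {u : List α} (hu : depth kind 0 u = some (h + 1)) :
    ∃ u' a x, u = u' ++ a :: x ∧ depth kind 0 u' = some h ∧ kind a = .call ∧
      WellMatched kind x := by
  induction hn : u.length using Nat.strong_induction_on generalizing h u with | _ n ih
  subst hn
  rcases List.eq_nil_or_concat u with rfl | ⟨w, c, rfl⟩
  · simp [depth] at hu
  · rw [List.concat_eq_append] at hu ih ⊢
    obtain ⟨d, hd, hc⟩ := exists_depth_of_append hu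
    cases hk : kind c with
    | call =>
      obtain rfl : d = h := by simpa [depth, hk, LetterKind.step] using hc
      exact ⟨w, c, [], rfl, hd, hk, .nil⟩
    | int =>
      obtain rfl : d = h + 1 := by simpa [depth, hk, LetterKind.step] using hc
      obtain ⟨u', a, x, rfl, hu', ha, hx⟩ := ih _ (by simp) hd rfl
      exact ⟨u', a, x ++ [c], by simp, hu', ha, hx.append' (.int hk)⟩
    | ret =>
      cases d with
      | zero => simp [depth, hk, LetterKind.step] at hc
      | succ d =>
        obtain rfl : d = h + 1 := by simpa [depth, hk, LetterKind.step] using hc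
        -- The final return closes the last call `a₁` pending before it, so the call sought is the
        -- one pending before `a₁`.
        obtain ⟨u₁, a₁, x₁, rfl, hu₁, ha₁, hx₁⟩ := ih _ (by simp) hd rfl
        obtain ⟨u₂, a₂, x₂, rfl, hu₂, ha₂, hx₂⟩ := ih _ (by simp) hu₁ rfl
        refine ⟨u₂, a₂, x₂ ++ a₁ :: (x₁ ++ [c]), by simp, hu₂, ha₂, hx₂.append' (.wrap ha₁ hk hx₁)⟩

end Words

/-! ### Contexts -/

section Contexts

variable {α : Type*} {kind : α → LetterKind}

instance : Monoid (Context kind) where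
  one := ⟨([], []), .nil⟩
  mul σ τ := ⟨(σ.1.1 ++ τ.1.1, τ.1.2 ++ σ.1.2), by
    simpa [IsContext] using WellMatched.insert τ.2 σ.2 _ _ rfl⟩
  mul_assoc σ τ ρ := Subtype.ext (by
    change ((_ ++ _) ++ _, _ ++ (_ ++ _)) = (_ ++ (_ ++ _), (_ ++ _) ++ _)
    simp)
  one_mul σ := Subtype.ext (by
    change ([] ++ σ.1.1, σ.1.2 ++ []) = _
    simp)
  mul_one σ := Subtype.ext (by
    change (σ.1.1 ++ [], [] ++ σ.1.2) = _
    simp)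

namespace Context

@[simp] theorem one_fst : (1 : Context kind).1.1 = [] := rfl
@[simp] theorem one_snd : (1 : Context kind).1.2 = [] := rfl
@[simp] theorem mul_fst (σ τ : Context kind) : (σ * τ).1.1 = σ.1.1 ++ τ.1.1 := rfl
@[simp] theorem mul_snd (σ τ : Context kind) : (σ * τ).1.2 = τ.1.2 ++ σ.1.2 := rfl

theorem ext_parts {σ τ : Context kind} (h₁ : σ.1.1 = τ.1.1) (h₂ : σ.1.2 = τ.1.2) : σ = τ :=
  Subtype.ext (Prod.ext h₁ h₂)

theorem prod_fst (l : List (Context kind)) : l.prod.1.1 = l.flatMap fun σ => σ.1.1 := by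
  induction l with
  | nil => rfl
  | cons σ l ih => simp [ih]

theorem prod_snd (l : List (Context kind)) :
    l.prod.1.2 = l.reverse.flatMap fun σ => σ.1.2 := by
  induction l with
  | nil => rfl
  | cons σ l ih => simp [ih]

theorem length_fst_pow (σ : Context kind) (n : ℕ) : (σ ^ n).1.1.length = n * σ.1.1.length := by
  induction n with
  | zero => simp
  | succ n ih => rw [pow_succ, mul_fst, List.length_append, ih]; ring

theorem length_snd_pow (σ : Context kind) (n : ℕ) : (σ ^ n).1.2.length = n * σ.1.2.length := by
  induction n with
  | zero => simp
  | succ n ih => rw [pow_succ, mul_snd, List.length_append, ih]; ring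

theorem height_fst_pow (σ : Context kind) (n : ℕ) :
    height kind (σ ^ n).1.1 = n * height kind σ.1.1 := by
  induction n with
  | zero => simp [height_nil]
  | succ n ih => rw [pow_succ, mul_fst, height_append, ih]; push_cast; ring

/-- The number of calls of the first component that are pending after it. -/
theorem exists_depth (σ : Context kind) :
    ∃ h : ℕ, depth kind 0 σ.1.1 = some h ∧ depth kind h σ.1.2 = some 0 ∧
      height kind σ.1.1 = h := by
  obtain ⟨h, h₁, h₂⟩ := exists_depth_of_append (wellMatched_iff_depth.1 σ.2)
  exact ⟨h, h₁, h₂, by simpa using (eq_add_height_of_depth h₁).symm⟩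

theorem height_snd (σ : Context kind) : height kind σ.1.2 = - height kind σ.1.1 := by
  have h := eq_add_height_of_depth (wellMatched_iff_depth.1 σ.2)
  rw [height_append] at h
  push_cast at h
  linarith

/-- A first component influences the second only through the number of calls it leaves pending. -/
theorem isContext_of_height_eq {σ τ : Context kind}
    (h : height kind σ.1.1 = height kind τ.1.1) : IsContext kind (σ.1.1, τ.1.2) := by
  obtain ⟨c, h₁, -, h₂⟩ := σ.exists_depth
  obtain ⟨d, -, h₃, h₄⟩ := τ.exists_depth
  obtain rfl : c = d := by exact_mod_cast (h₂.symm.trans (h.trans h₄))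
  rw [IsContext, wellMatched_iff_depth, depth_append_of_eq h₁, h₃]

/-- Two contexts of the same height can be mixed. -/
def mix (σ τ : Context kind) (h : height kind σ.1.1 = height kind τ.1.1) : Context kind :=
  ⟨(σ.1.1, τ.1.2), isContext_of_height_eq h⟩

theorem length_pos_of_height_pos {σ : Context kind} (h : 0 < height kind σ.1.1) :
    0 < σ.1.1.length ∧ 0 < σ.1.2.length := by
  constructor
  · refine List.length_pos_iff.2 fun h' => ?_
    rw [h', height_nil] at h
    exact h.false
  · refine List.length_pos_iff.2 fun h' => ?_
    have := σ.height_snd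
    rw [h', height_nil] at this
    omega

/-- The context `(x, y)` for well-matched `x` and `y`. -/
def ofWords {x y : List α} (hx : WellMatched kind x) (hy : WellMatched kind y) : Context kind :=
  ⟨(x, y), hx.append' hy⟩

/-- The context `(a, b)` for a call letter `a` and a return letter `b`. -/
def ofLetters {a b : α} (ha : kind a = .call) (hb : kind b = .ret) : Context kind :=
  ⟨([a], [b]), WellMatched.wrap ha hb .nil⟩

@[simp] theorem ofWords_fst {x y : List α} (hx : WellMatched kind x) (hy : WellMatched kind y) :
    (ofWords hx hy).1.1 = x := rfl
@[simp] theorem ofWords_snd {x y : List α} (hx : WellMatched kind x) (hy : WellMatched kind y) :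
    (ofWords hx hy).1.2 = y := rfl
@[simp] theorem ofLetters_fst {a b : α} (ha : kind a = .call) (hb : kind b = .ret) :
    (ofLetters ha hb).1.1 = [a] := rfl
@[simp] theorem ofLetters_snd {a b : α} (ha : kind a = .call) (hb : kind b = .ret) :
    (ofLetters ha hb).1.2 = [b] := rfl

/-- Decomposition of a context at the innermost pending call. -/
theorem exists_innermost {h : ℕ} {σ : Context kind} (hσ : height kind σ.1.1 = (h + 1 : ℕ)) :
    ∃ (σ' : Context kind) (a b : α) (ha : kind a = .call) (hb : kind b = .ret) (x y : List α)
      (hx : WellMatched kind x) (hy : WellMatched kind y), height kind σ'.1.1 = h ∧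
      σ = σ' * ofLetters ha hb * ofWords hx hy := by
  obtain ⟨c, h₁, h₂, h₃⟩ := σ.exists_depth
  obtain rfl : c = h + 1 := by exact_mod_cast h₃.symm.trans hσ
  obtain ⟨u, a, x, hu, hu', ha, hx⟩ := exists_last_call h₁
  obtain ⟨y, b, v, hv, hy, hb, hv'⟩ := returnForm_of_depth h₂
  have hv'' : depth kind h v = some 0 := by
    have := h₂
    rw [hv, depth_append_of_eq (hy.depth_eq _)] at this
    simpa [depth, hb, LetterKind.step] using this
  refine ⟨⟨(u, v), ?_⟩, a, b, ha, hb, x, y, hx, hy, ?_, ?_⟩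
  · rw [IsContext, wellMatched_iff_depth, depth_append_of_eq hu', hv'']
  · simpa using (eq_add_height_of_depth hu').symm
  · refine ext_parts (hu.trans ?_) (hv.trans ?_)
    · change _ = (u ++ [a]) ++ x
      simp
    · change _ = y ++ ([b] ++ v)
      simp

theorem exists_ofWords {σ : Context kind} (hσ : height kind σ.1.1 = 0) :
    ∃ (x y : List α) (hx : WellMatched kind x) (hy : WellMatched kind y), σ = ofWords hx hy := by
  obtain ⟨c, h₁, h₂, h₃⟩ := σ.exists_depth
  obtain rfl : c = 0 := by exact_mod_cast h₃.symm.trans hσ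
  exact ⟨_, _, wellMatched_iff_depth.2 h₁, wellMatched_iff_depth.2 h₂, rfl⟩

end Context

end Contexts

/-! ### Runs of DVPAs -/

namespace DVPA

variable {α Q Γ : Type*} {kind : α → LetterKind} (A : DVPA kind Q Γ)

theorem run_append (q : Q) (u v : List α) (β : List Γ) :
    A.run q (u ++ v) β = A.run (A.run q u β).1 v (A.run q u β).2 := by
  induction u generalizing q β with
  | nil => rfl
  | cons a u ih =>
    cases β with
    | nil => cases v <;> rfl
    | cons γ β => exact ih _ _

theorem run_nil_stack (q : Q) (u : List α) : A.run q u [] = (q, []) := by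
  cases u <;> rfl

theorem exists_run_wellMatched {w : List α} (hw : WellMatched kind w) (q : Q) (γ : Γ) :
    ∃ q', ∀ β, A.run q w (γ :: β) = (q', γ :: β) := by
  induction hw generalizing q γ with
  | nil => exact ⟨q, fun _ => rfl⟩
  | @int c hc =>
    refine ⟨(A.δ q c γ).1, fun β => ?_⟩
    simp [run, A.δ_int q c γ hc]
  | @wrap a b w ha hb _ ih =>
    obtain ⟨δ, -, hδ⟩ := A.δ_call q a γ ha
    obtain ⟨q', hq'⟩ := ih (A.δ q a γ).1 δ
    refine ⟨(A.δ q' b δ).1, fun β => ?_⟩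
    simp [run, hδ, run_append, hq', A.δ_ret q' b δ hb]
  | append _ _ _ _ ih₁ ih₂ =>
    obtain ⟨q₁, h₁⟩ := ih₁ q γ
    obtain ⟨q₂, h₂⟩ := ih₂ q₁ γ
    exact ⟨q₂, fun β => by rw [run_append, h₁, h₂]⟩

theorem run_eq_of_wellMatched {w : List α} (hw : WellMatched kind w) (q : Q) (γ : Γ)
    (β : List Γ) : A.run q w (γ :: β) = ((A.run q w [γ]).1, γ :: β) := by
  obtain ⟨q', h⟩ := A.exists_run_wellMatched hw q γ
  rw [h, h]

/-- The symbols below the top count the pending calls. Popping the last symbol empties the stack for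
good, so a run that ends with a nonempty stack meets no unmatched return. -/
theorem depth_of_run {w : List α} {q : Q} {γ : Γ} {β : List Γ} {q' : Q} {γ' : Γ} {β' : List Γ}
    (h : A.run q w (γ :: β) = (q', γ' :: β')) : depth kind β.length w = some β'.length := by
  induction w generalizing q γ β with
  | nil =>
    obtain ⟨-, h⟩ := Prod.ext_iff.1 h
    obtain ⟨-, rfl⟩ := List.cons.inj h
    rfl
  | cons a w ih =>
    rw [run] at h
    cases hk : kind a with
    | call =>
      obtain ⟨δ, -, hδ⟩ := A.δ_call q a γ hk
      rw [hδ] at h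
      simpa [depth, hk, LetterKind.step] using ih h
    | int =>
      rw [A.δ_int q a γ hk] at h
      simpa [depth, hk, LetterKind.step] using ih h
    | ret =>
      rw [A.δ_ret q a γ hk] at h
      cases β with
      | nil => simp [run_nil_stack] at h
      | cons δ β => simpa [depth, hk, LetterKind.step] using ih h

theorem wellMatched_of_mem_language {w : List α} (hw : w ∈ A.language) : WellMatched kind w := by
  rw [wellMatched_iff_depth]
  exact A.depth_of_run (Prod.ext rfl hw.2)

/-- The transformation of states, depending on the top of the stack, induced by a word. -/
def transition (w : List α) (q : Q) (γ : Γ) : Q := (A.run q w [γ]).1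

theorem run_eq_run {x y : List α} (hx : WellMatched kind x) (hy : WellMatched kind y)
    (h : A.transition x = A.transition y) (q : Q) (β : List Γ) : A.run q x β = A.run q y β := by
  cases β with
  | nil => simp [run_nil_stack]
  | cons γ β =>
    rw [A.run_eq_of_wellMatched hx, A.run_eq_of_wellMatched hy]
    exact congrArg (fun f => (f q γ, γ :: β)) h

theorem mem_language_iff_of_transition_eq {x y : List α} (hx : WellMatched kind x)
    (hy : WellMatched kind y) (h : A.transition x = A.transition y) (u v : List α) :
    u ++ x ++ v ∈ A.language ↔ u ++ y ++ v ∈ A.language := by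
  have : A.run A.start (u ++ x ++ v) [A.bot] = A.run A.start (u ++ y ++ v) [A.bot] := by
    simp only [run_append, A.run_eq_run hx hy h]
  change _ ∧ _ ↔ _ ∧ _
  rw [this]

end DVPA

/-! ### The syntactic Ext-algebra -/

section Syntactic

variable {α : Type*} (kind : α → LetterKind) (L : Language α)

/-- The monoid `R_L`. -/
abbrev SynMonoid : Type _ := (synCongruence kind L).con.Quotient

/-- The monoid `O_L`. -/
abbrev SynOps : Type _ := (synCongruence kind L).quotient.ops

/-- The morphism `φ_L`. -/
def synWord (w : WMWord kind) : SynMonoid kind L := (synCongruence kind L).hom.φ w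

/-- The element of `O_L` given by a context. -/
def synOp : Context kind →* SynOps kind L where
  toFun σ := (synCongruence kind L).hom.ψ (extOp σ)
  map_one' := by
    rw [← map_one (synCongruence kind L).hom.ψ]
    congr 1
    apply Subtype.ext
    funext x
    apply Subtype.ext
    change [] ++ x.1 ++ [] = x.1
    simp
  map_mul' σ τ := by
    rw [← map_mul]
    congr 1
    apply Subtype.ext
    funext x
    apply Subtype.ext
    change (σ.1.1 ++ τ.1.1) ++ x.1 ++ (τ.1.2 ++ σ.1.2) = σ.1.1 ++ (τ.1.1 ++ x.1 ++ τ.1.2) ++ σ.1.2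
    simp

variable {kind L}

theorem synWord_eq_iff {x y : WMWord kind} :
    synWord kind L x = synWord kind L y ↔
      ∀ ρ : Context kind, (ρ.1.1 ++ x.1 ++ ρ.1.2 ∈ L ↔ ρ.1.1 ++ y.1 ++ ρ.1.2 ∈ L) := by
  refine (Con.eq (synCongruence kind L).con).trans ⟨fun h ρ => h (extOp ρ), fun h f => ?_⟩
  obtain ⟨_, ρ, rfl⟩ := f
  exact h ρ

theorem synOp_apply (σ : Context kind) (x : WMWord kind) :
    (synOp kind L σ).1 (synWord kind L x) = synWord kind L (ext σ x) := rfl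

theorem synOp_eq_iff {σ τ : Context kind} :
    synOp kind L σ = synOp kind L τ ↔
      ∀ x : WMWord kind, synWord kind L (ext σ x) = synWord kind L (ext τ x) := by
  refine ⟨fun h x => ?_, fun h => ?_⟩
  · rw [← synOp_apply, ← synOp_apply, h]
  · apply Subtype.ext
    funext q
    induction q using Con.induction_on with
    | H x => exact h x

theorem synOp_eq_iff_mem {σ τ : Context kind} :
    synOp kind L σ = synOp kind L τ ↔ ∀ (ρ : Context kind) (x : WMWord kind),
      (ρ.1.1 ++ (σ.1.1 ++ x.1 ++ σ.1.2) ++ ρ.1.2 ∈ L ↔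
        ρ.1.1 ++ (τ.1.1 ++ x.1 ++ τ.1.2) ++ ρ.1.2 ∈ L) := by
  rw [synOp_eq_iff]
  exact ⟨fun h ρ x => synWord_eq_iff.1 (h x) ρ, fun h x => synWord_eq_iff.2 fun ρ => h ρ x⟩

theorem synWord_append_congr {x x' y y' : WMWord kind} (hx : synWord kind L x = synWord kind L x')
    (hy : synWord kind L y = synWord kind L y') :
    synWord kind L (x * y) = synWord kind L (x' * y') := by
  unfold synWord at *
  rw [map_mul, map_mul, hx, hy]

theorem synOp_ofWords_congr {x x' y y' : WMWord kind} (hx : synWord kind L x = synWord kind L x')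
    (hy : synWord kind L y = synWord kind L y') :
    synOp kind L (Context.ofWords x.2 y.2) = synOp kind L (Context.ofWords x'.2 y'.2) := by
  rw [synOp_eq_iff]
  intro z
  exact synWord_append_congr (synWord_append_congr hx rfl) hy

theorem exists_synOp_eq (e : SynOps kind L) : ∃ σ : Context kind, synOp kind L σ = e := by
  obtain ⟨e, f, ⟨σ, rfl⟩, hf⟩ := e
  refine ⟨σ, Subtype.ext (funext fun q => ?_)⟩
  induction q using Con.induction_on with
  | H x => exact (hf x).symm

theorem exists_mem_of_reachableOp {σ : Context kind}
    (h : (synCongruence kind L).quotient.ReachableOp (synImage kind L) (synOp kind L σ)) :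
    ∃ (ρ : Context kind) (x : WMWord kind), ρ.1.1 ++ (σ.1.1 ++ x.1 ++ σ.1.2) ++ ρ.1.2 ∈ L := by
  obtain ⟨r, f, hf⟩ := h
  induction r using Con.induction_on with
  | H x =>
    obtain ⟨ρ, rfl⟩ := exists_synOp_eq f
    obtain ⟨w, hw, hw'⟩ := hf
    refine ⟨ρ, x, ?_⟩
    have h₁ : synWord kind L w = synWord kind L (ext ρ (ext σ x)) := hw'
    have h₂ := (synWord_eq_iff.1 h₁) 1
    simp only [Context.one_fst, Context.one_snd, List.nil_append, List.append_nil] at h₂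
    exact h₂.1 hw

theorem isWeaklyLengthSynchronous_iff : IsWeaklyLengthSynchronous kind L ↔
    ∀ e : SynOps kind L, IsIdempotentElem e →
      (synCongruence kind L).quotient.ReachableOp (synImage kind L) e →
      ∀ σ τ, synOp kind L σ = e → synOp kind L τ = e →
        0 < height kind σ.1.1 → 0 < height kind τ.1.1 →
        (σ.1.1 = τ.1.1 → σ.1.2.length = τ.1.2.length) ∧
        (σ.1.2 = τ.1.2 → σ.1.1.length = τ.1.1.length) :=
  ⟨fun h e he hr σ τ hσ hτ => h e he hr σ hσ τ hτ, fun h e he hr σ hσ τ hτ => h e he hr σ τ hσ hτ⟩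

/-- A well-matched word acts on a run only through its map from pairs (state, top symbol) to states,
and words with the same map are syntactically equivalent. -/
theorem finite_synMonoid_of_dvpa {Q Γ : Type*} [Finite Q] [Finite Γ] (A : DVPA kind Q Γ) :
    Finite (SynMonoid kind A.language) ∧
      Nat.card (SynMonoid kind A.language) ≤ Nat.card Q ^ (Nat.card Q * Nat.card Γ) := by
  have hinj : Function.Injective fun r : SynMonoid kind A.language =>
      fun p : Q × Γ => A.transition (Quotient.out r : WMWord kind).1 p.1 p.2 := by
    intro r r' h
    rw [← Quotient.out_eq r, ← Quotient.out_eq r']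
    refine synWord_eq_iff.2 fun ρ => A.mem_language_iff_of_transition_eq (Quotient.out r).2
      (Quotient.out r').2 ?_ _ _
    funext q γ
    exact congrFun h (q, γ)
  refine ⟨Finite.of_injective _ hinj, (Nat.card_le_card_of_injective _ hinj).trans_eq ?_⟩
  rw [Nat.card_fun, Nat.card_prod]

theorem card_synOps_le [Finite (SynMonoid kind L)] : Finite (SynOps kind L) ∧
    Nat.card (SynOps kind L) ≤ Nat.card (SynMonoid kind L) ^ Nat.card (SynMonoid kind L) := by
  have hinj : Function.Injective (α := SynOps kind L) (β := SynMonoid kind L → SynMonoid kind L)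
      fun e => e.1 := fun _ _ h => Subtype.ext h
  refine ⟨Finite.of_injective _ hinj, (Nat.card_le_card_of_injective _ hinj).trans_eq ?_⟩
  rw [Nat.card_fun]

end Syntactic

/-! ### Short contexts -/

section Loops

variable {C M : Type*} [Monoid C] [Monoid M] [Finite M] (P : C →* M)

/-- Pigeonhole on the prefixes of length at most `Nat.card M`; all of them are proper, whence `l₃ ≠
[]`. -/
theorem exists_loop (a : M) (l : List C) (h : Nat.card M < l.length) :
    ∃ l₁ l₂ l₃ : List C, l = l₁ ++ l₂ ++ l₃ ∧ l₂ ≠ [] ∧ l₃ ≠ [] ∧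
      l₁.length + l₂.length ≤ Nat.card M ∧ a * P l₁.prod * P l₂.prod = a * P l₁.prod := by
  classical
  have := Fintype.ofFinite M
  obtain ⟨i, j, hij, hP⟩ := Fintype.exists_ne_map_eq_of_card_lt
    (fun i : Fin (Nat.card M + 1) => a * P (l.take i).prod) (by simp [Nat.card_eq_fintype_card])
  wlog hlt : i < j generalizing i j
  · exact this j i hij.symm hP.symm (lt_of_le_of_ne (not_lt.1 hlt) hij.symm)
  have hlt' : i.1 < j.1 := hlt
  have hj := j.2
  have htake : l.take j = l.take i ++ (l.drop i).take (j.1 - i.1) := by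
    rw [← List.take_add, Nat.add_sub_cancel' hlt'.le]
  refine ⟨l.take i, (l.drop i).take (j.1 - i.1), l.drop j, ?_, ?_, ?_, ?_, ?_⟩
  · rw [← htake, List.take_append_drop]
  · intro h'
    have := congrArg List.length h'
    simp at this
    omega
  · intro h'
    have := congrArg List.length h'
    simp at this
    omega
  · simp only [List.length_take, List.length_drop]
    omega
  · rw [mul_assoc, ← map_mul, ← List.prod_append, ← htake]
    exact hP.symm

/-- Loops are cut out until the list is short. It stays nonempty because a loop never reaches its
end; later, a nonempty list of layers means positive height. -/
theorem exists_short_list (G : Set C) (a : M) (l : List C) (hl : ∀ x ∈ l, x ∈ G) (hne : l ≠ []) :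
    ∃ l' : List C, (∀ x ∈ l', x ∈ G) ∧ l' ≠ [] ∧ l'.length ≤ Nat.card M ∧
      a * P l'.prod = a * P l.prod := by
  induction hn : l.length using Nat.strong_induction_on generalizing l with | _ n ih
  subst hn
  by_cases h : l.length ≤ Nat.card M
  · exact ⟨l, hl, hne, h, rfl⟩
  obtain ⟨l₁, l₂, l₃, rfl, h₂, h₃, -, hP⟩ := exists_loop P a l (not_le.1 h)
  obtain ⟨l', h₁', h₂', h₃', h₄'⟩ := ih (l₁ ++ l₃).length
    (by have := List.length_pos_iff.2 h₂; simp; omega) (l₁ ++ l₃)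
    (fun x hx => hl x (by simp at hx ⊢; tauto)) (by simp [h₃]) rfl
  refine ⟨l', h₁', h₂', h₃', h₄'.trans ?_⟩
  simp only [List.prod_append, map_mul, ← mul_assoc, hP]

/-- An additive weight that vanishes on short paths to `e` vanishes on all paths to `e`. -/
theorem weight_eq_zero (G : Set C) (w : C → ℤ) (hw : ∀ x y, w (x * y) = w x + w y) (b : C) (e : M)
    (hshort : ∀ l : List C, (∀ x ∈ l, x ∈ G) → l ≠ [] → l.length ≤ 2 * Nat.card M →
      P (b * l.prod) = e → w (b * l.prod) = 0)
    (l : List C) (hl : ∀ x ∈ l, x ∈ G) (hne : l ≠ []) (he : P (b * l.prod) = e) :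
    w (b * l.prod) = 0 := by
  induction hn : l.length using Nat.strong_induction_on generalizing l with | _ n ih
  subst hn
  by_cases h : l.length ≤ Nat.card M
  · exact hshort l hl hne (by omega) he
  -- With a short replacement `l₄` of `l₃`, both `l₁ ++ l₄` and `l₁ ++ l₂ ++ l₄` have length at most
  -- `2 * Nat.card M`. Comparing their weights shows that the loop `l₂` has weight zero, and the
  -- path without the loop is covered by induction.
  obtain ⟨l₁, l₂, l₃, rfl, h₂, h₃, hlen, hP⟩ := exists_loop P (P b) l (not_le.1 h)
  obtain ⟨l₄, hG₄, h₄, hlen₄, hP₄⟩ := exists_short_list P G (P b * P l₁.prod) l₃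
    (fun x hx => hl x (by simp [hx])) h₃
  have hE : P b * P l₁.prod * P l₃.prod = e := by
    rw [← he]
    simp only [List.prod_append, map_mul, ← mul_assoc, hP]
  have e₁ := ih (l₁ ++ l₃).length
    (by have := List.length_pos_iff.2 h₂; simp; omega) (l₁ ++ l₃)
    (fun x hx => hl x (by simp at hx ⊢; tauto)) (by simp [h₃])
    (by simpa [List.prod_append, ← mul_assoc] using hE) rfl
  have hmem : ∀ x ∈ l₁ ++ l₂ ++ l₄, x ∈ G := by
    intro x hx
    simp only [List.mem_append] at hx hl
    rcases hx with (hx | hx) | hx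
    · exact hl x (.inl (.inl hx))
    · exact hl x (.inl (.inr hx))
    · exact hG₄ x hx
  have e₂ := hshort (l₁ ++ l₄) (fun x hx => hmem x (by simp at hx ⊢; tauto)) (by simp [h₄])
    (by simp; omega) (by simpa [List.prod_append, ← mul_assoc, hP₄] using hE)
  have e₃ := hshort (l₁ ++ l₂ ++ l₄) hmem (by simp [h₄])
    (by simp; omega) (by simpa [List.prod_append, ← mul_assoc, hP, hP₄] using hE)
  simp only [List.prod_append, hw] at e₁ e₂ e₃ ⊢
  linarith

end Loops

/-! ### Short representatives of words and contexts in their syntactic classes -/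

section Short

variable {α : Type*} {kind : α → LetterKind} {L : Language α}

/-- The classes that have a representative of length at most `4 ^ (i + 1)` form an increasing chain,
stationary at some `i` up to the size of `R_L`. There the set is closed under wrapping and
concatenation, because the next bound leaves room for two more letters and for doubling the length.
-/
theorem exists_short_word [Finite (SynMonoid kind L)] (x : WMWord kind) :
    ∃ y : WMWord kind, synWord kind L y = synWord kind L x ∧
      y.1.length ≤ 4 ^ (Nat.card (SynMonoid kind L) + 1) := by
  let S : ℕ → Set (SynMonoid kind L) := fun i =>
    {r | ∃ y : WMWord kind, synWord kind L y = r ∧ y.1.length ≤ 4 ^ (i + 1)}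
  have hmono : Monotone S := fun i j hij r ⟨y, hy, hlen⟩ =>
    ⟨y, hy, hlen.trans (Nat.pow_le_pow_right (by norm_num) (by omega))⟩
  have hstab : ∃ i ≤ Nat.card (SynMonoid kind L), S i = S (i + 1) := by
    by_contra! hcon
    have hcard : ∀ i ≤ Nat.card (SynMonoid kind L) + 1, i ≤ (S i).ncard := by
      intro i hi
      induction i with
      | zero => exact Nat.zero_le _
      | succ i ih =>
        exact (ih (by omega)).trans_lt (Set.ncard_lt_ncard
          ((hmono i.le_succ).ssubset_of_ne (hcon i (by omega))) (Set.toFinite _))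
    have h₁ := hcard _ le_rfl
    have h₂ := Set.ncard_le_card (S (Nat.card (SynMonoid kind L) + 1))
    omega
  obtain ⟨i, hi, hS⟩ := hstab
  have hfour : 4 ≤ 4 ^ (i + 1) := by
    rw [pow_succ]
    have := Nat.one_le_pow i 4 (by norm_num)
    omega
  have hall : ∀ w (hw : WellMatched kind w), synWord kind L ⟨w, hw⟩ ∈ S i := by
    intro w hw
    induction hw with
    | nil => exact ⟨_, rfl, Nat.zero_le _⟩
    | int hc => exact ⟨⟨_, .int hc⟩, rfl, by simp; omega⟩
    | @wrap a b w ha hb hw ih =>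
      obtain ⟨y, hy, hlen⟩ := ih
      rw [hS]
      refine ⟨⟨_, .wrap ha hb y.2⟩, ?_, ?_⟩
      · have h := congrArg (synOp kind L (.ofLetters ha hb)).1 hy
        exact h
      · rw [pow_succ]
        simp
        omega
    | @append u v _ _ hu hv ih₁ ih₂ =>
      obtain ⟨y₁, hy₁, hlen₁⟩ := ih₁
      obtain ⟨y₂, hy₂, hlen₂⟩ := ih₂
      rw [hS]
      refine ⟨y₁ * y₂, synWord_append_congr hy₁ hy₂, ?_⟩
      change (y₁.1 ++ y₂.1).length ≤ _
      rw [pow_succ]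
      simp
      omega
  exact hmono hi (hall x.1 x.2)

theorem Context.height_fst_prod (l : List (Context kind)) (hl : ∀ σ ∈ l, height kind σ.1.1 = 1) :
    height kind l.prod.1.1 = l.length := by
  induction l with
  | nil => simp [height_nil]
  | cons σ l ih =>
    rw [List.prod_cons, mul_fst, height_append, ih fun τ hτ => hl τ (by simp [hτ]),
      hl σ (by simp)]
    simp
    ring

theorem Context.length_prod_le (l : List (Context kind)) (c : ℕ)
    (hl : ∀ σ ∈ l, σ.1.1.length ≤ c ∧ σ.1.2.length ≤ c) :
    l.prod.1.1.length ≤ l.length * c ∧ l.prod.1.2.length ≤ l.length * c := by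
  induction l with
  | nil => simp
  | cons σ l ih =>
    have h₁ := ih fun τ hτ => hl τ (by simp [hτ])
    have h₂ := hl σ (by simp)
    simp only [List.prod_cons, mul_fst, mul_snd, List.length_append, List.length_cons, add_mul]
    omega

/-- Contexts of height one and length at most `c`. -/
def shortLayers (kind : α → LetterKind) (c : ℕ) : Set (Context kind) :=
  {σ | height kind σ.1.1 = 1 ∧ σ.1.1.length ≤ c ∧ σ.1.2.length ≤ c}

/-- The well-matched factors between pending letters are replaced by short ones, on the left to get
`σ₁`, then on the right as well. Each of the two steps fixes one component, so over a reachable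
idempotent and at positive height weak length-synchronicity applies to each step: the normal form
has the same two lengths as `σ`. -/
theorem exists_normal_form [Finite (SynMonoid kind L)] {c : ℕ}
    (hc : c = 4 ^ (Nat.card (SynMonoid kind L) + 1)) (h : ℕ) (σ : Context kind)
    (hσ : height kind σ.1.1 = h) :
    ∃ (σ₁ b : Context kind) (l : List (Context kind)), σ₁.1.2 = σ.1.2 ∧
      (b * l.prod).1.1 = σ₁.1.1 ∧ synOp kind L σ₁ = synOp kind L σ ∧
      synOp kind L (b * l.prod) = synOp kind L σ ∧ height kind b.1.1 = 0 ∧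
      b.1.1.length ≤ c ∧ b.1.2.length ≤ c ∧ (∀ τ ∈ l, τ ∈ shortLayers kind (c + 1)) ∧
      l.length = h := by
  induction h generalizing σ with
  | zero =>
    obtain ⟨x, y, hx, hy, rfl⟩ := Context.exists_ofWords (by simpa using hσ)
    obtain ⟨x', hx', hlx⟩ := exists_short_word (L := L) ⟨x, hx⟩
    obtain ⟨y', hy', hly⟩ := exists_short_word (L := L) ⟨y, hy⟩
    refine ⟨.ofWords x'.2 hy, .ofWords x'.2 y'.2, [], rfl, by simp, ?_, ?_, ?_,
      hc ▸ hlx, hc ▸ hly, by simp, rfl⟩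
    · exact synOp_ofWords_congr (y := ⟨y, hy⟩) (y' := ⟨y, hy⟩) (x' := ⟨x, hx⟩) hx' rfl
    · rw [List.prod_nil, mul_one]
      exact synOp_ofWords_congr hx' hy'
    · simpa using (eq_add_height_of_depth (x'.2.depth_eq 0)).symm
  | succ h ih =>
    obtain ⟨σ', a, b, ha, hb, x, y, hx, hy, hσ', rfl⟩ := Context.exists_innermost hσ
    obtain ⟨x', hx', hlx⟩ := exists_short_word (L := L) ⟨x, hx⟩
    obtain ⟨y', hy', hly⟩ := exists_short_word (L := L) ⟨y, hy⟩
    obtain ⟨σ₁, d, l, h₁, h₂, h₃, h₄, h₅, h₆, h₇, h₈, h₉⟩ := ih σ' hσ'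
    have e₁ : synOp kind L (.ofWords x'.2 hy) = synOp kind L (.ofWords hx hy) :=
      synOp_ofWords_congr (y := ⟨y, hy⟩) (y' := ⟨y, hy⟩) (x' := ⟨x, hx⟩) hx' rfl
    have e₂ : synOp kind L (.ofWords x'.2 y'.2) = synOp kind L (.ofWords hx hy) :=
      synOp_ofWords_congr hx' hy'
    refine ⟨σ₁ * .ofLetters ha hb * .ofWords x'.2 hy, d,
      l ++ [.ofLetters ha hb * .ofWords x'.2 y'.2], ?_, ?_, ?_, ?_, h₅, h₆, h₇, ?_, ?_⟩
    · simp [h₁]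
    · simp only [List.prod_append, List.prod_singleton, ← mul_assoc, Context.mul_fst] at h₂ ⊢
      rw [h₂]
      rfl
    · simp only [map_mul, h₃, e₁]
    · simp only [List.prod_append, List.prod_singleton, ← mul_assoc, map_mul, e₂] at h₄ ⊢
      rw [h₄]
    · intro τ hτ
      rcases List.mem_append.1 hτ with hτ | hτ
      · exact h₈ τ hτ
      · obtain rfl := List.mem_singleton.1 hτ
        refine ⟨?_, ?_, ?_⟩
        · rw [Context.mul_fst, height_append]
          change height kind [a] + height kind x'.1 = 1
          have := eq_add_height_of_depth (x'.2.depth_eq 0)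
          simp [height, ha] at this ⊢
          omega
        · change ([a] ++ x'.1).length ≤ _
          simp
          omega
        · change (y'.1 ++ [b]).length ≤ _
          simp
          omega
    · simp [h₉]

theorem ratio_eq_iff {σ τ : Context kind} (hσ : 0 < height kind σ.1.1)
    (hτ : 0 < height kind τ.1.1) :
    (σ.1.1.length : ℚ) / (σ.1.2.length : ℚ) = (τ.1.1.length : ℚ) / (τ.1.2.length : ℚ) ↔
      σ.1.1.length * τ.1.2.length = τ.1.1.length * σ.1.2.length := by
  have h₁ := (Context.length_pos_of_height_pos hσ).2
  have h₂ := (Context.length_pos_of_height_pos hτ).2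
  rw [div_eq_div_iff (by positivity) (by positivity)]
  exact_mod_cast Iff.rfl

/-- If a language is weakly length-synchronous but not length-synchronous, then short contexts
witness this. -/
theorem exists_short_witnesses [Finite (SynMonoid kind L)] [Finite (SynOps kind L)]
    (hweak : IsWeaklyLengthSynchronous kind L) (hnot : ¬ IsLengthSynchronous kind L) {c B : ℕ}
    (hc : c = 4 ^ (Nat.card (SynMonoid kind L) + 1))
    (hB : B = c + 2 * Nat.card (SynOps kind L) * (c + 1)) :
    ∃ (e : SynOps kind L) (σ τ : Context kind), IsIdempotentElem e ∧
      (synCongruence kind L).quotient.ReachableOp (synImage kind L) e ∧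
      synOp kind L σ = e ∧ synOp kind L τ = e ∧
      0 < height kind σ.1.1 ∧ 0 < height kind τ.1.1 ∧
      (σ.1.1.length ≤ B ∧ σ.1.2.length ≤ B) ∧ (τ.1.1.length ≤ B ∧ τ.1.2.length ≤ B) ∧
      σ.1.1.length * τ.1.2.length ≠ τ.1.1.length * σ.1.2.length := by
  by_contra! hcon
  refine hnot fun e he hr => ?_
  rw [isWeaklyLengthSynchronous_iff] at hweak
  have hweak := hweak e he hr
  have hcon := fun σ τ => hcon e σ τ he hr
  -- if all short contexts have slope `p / q` then all contexts have
  have key : ∀ p q : ℤ, (∀ τ : Context kind, synOp kind L τ = e → 0 < height kind τ.1.1 →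
      τ.1.1.length ≤ B → τ.1.2.length ≤ B → q * τ.1.1.length = p * τ.1.2.length) →
      ∀ τ : Context kind, synOp kind L τ = e → 0 < height kind τ.1.1 →
        q * τ.1.1.length = p * τ.1.2.length := by
    intro p q hpq τ hτ hpos
    obtain ⟨h, -, -, hh⟩ := τ.exists_depth
    obtain ⟨σ₁, b, l, h₁, h₂, h₃, h₄, h₅, h₆, h₇, h₈, h₉⟩ := exists_normal_form hc h τ hh
    have hheight : ∀ l : List (Context kind), (∀ τ ∈ l, τ ∈ shortLayers kind (c + 1)) →
        height kind (b * l.prod).1.1 = l.length := fun l hl => by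
      rw [Context.mul_fst, height_append, h₅, Context.height_fst_prod l fun τ hτ => (hl τ hτ).1,
        zero_add]
    have hpos₂ : 0 < height kind (b * l.prod).1.1 := by
      rw [hheight l h₈, h₉, ← hh]
      exact hpos
    have hpos₁ : 0 < height kind σ₁.1.1 := h₂ ▸ hpos₂
    have hlen₁ := (hweak τ σ₁ hτ (h₃.trans hτ) hpos hpos₁).2 h₁.symm
    have hlen₂ := (hweak σ₁ (b * l.prod) (h₃.trans hτ) (h₄.trans hτ) hpos₁ hpos₂).1 h₂.symm
    -- The slope condition is the vanishing of an additive weight, which `weight_eq_zero` reduces to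
    -- products of boundedly many short layers.
    let w : Context kind → ℤ := fun σ => q * σ.1.1.length - p * σ.1.2.length
    have hzero : w (b * l.prod) = 0 := by
      refine weight_eq_zero (synOp kind L) (shortLayers kind (c + 1)) w (fun σ τ => ?_) b e ?_ l h₈
        ?_ (h₄.trans hτ)
      · simp only [w, Context.mul_fst, Context.mul_snd, List.length_append]
        push_cast
        ring
      · intro l hl hne hlen hle
        have hb := Context.length_prod_le l (c + 1) fun σ hσ => (hl σ hσ).2
        have hle' : l.length * (c + 1) ≤ 2 * Nat.card (SynOps kind L) * (c + 1) :=
          Nat.mul_le_mul_right _ hlen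
        refine sub_eq_zero.2 (hpq _ hle ?_ ?_ ?_)
        · rw [hheight l hl]
          exact_mod_cast List.length_pos_iff.2 hne
        · rw [Context.mul_fst, List.length_append]
          omega
        · rw [Context.mul_snd, List.length_append]
          omega
      · rintro rfl
        rw [hheight [] (by simp)] at hpos₂
        simp at hpos₂
    have := sub_eq_zero.1 hzero
    rw [h₂, ← hlen₂] at this
    rw [hlen₁, this, h₁]
  intro σ hσ τ hτ hσpos hτpos
  rw [ratio_eq_iff hσpos hτpos]
  -- A short context over `e` determines the slope common to all. If there is none, the hypothesis
  -- of `key` is vacuous and the slope of `σ` itself can be used.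
  by_cases hex : ∃ ρ : Context kind, synOp kind L ρ = e ∧ 0 < height kind ρ.1.1 ∧
      ρ.1.1.length ≤ B ∧ ρ.1.2.length ≤ B
  · obtain ⟨ρ, hρ, hρpos, hρ₁, hρ₂⟩ := hex
    have hk := key ρ.1.1.length ρ.1.2.length fun τ' h₁ h₂ h₃ h₄ => by
      have := hcon τ' ρ h₁ hρ h₂ hρpos ⟨h₃, h₄⟩ ⟨hρ₁, hρ₂⟩
      rw [mul_comm]
      exact_mod_cast this
    have e₁ := hk σ hσ hσpos
    have e₂ := hk τ hτ hτpos
    have hne : (ρ.1.2.length : ℤ) ≠ 0 := by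
      have := (Context.length_pos_of_height_pos hρpos).2
      omega
    have : (σ.1.1.length : ℤ) * τ.1.2.length = τ.1.1.length * σ.1.2.length := by
      apply mul_left_cancel₀ hne
      rw [← mul_assoc, ← mul_assoc, e₁, e₂]
      ring
    exact_mod_cast this
  · push Not at hex
    have hk := key σ.1.1.length σ.1.2.length fun τ' h₁ h₂ h₃ h₄ => by
      have := hex τ' h₁ h₂ h₃
      omega
    have e₂ := hk τ hτ hτpos
    have : (σ.1.1.length : ℤ) * τ.1.2.length = τ.1.1.length * σ.1.2.length := by
      rw [← e₂]
      ring
    exact_mod_cast this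

end Short

/-! ### Recognising equal sequences of blocks by finitely many tests -/

/-- By induction Fⁱ Rⁱ = e for all i > 0. If Fⁱ = Fⁿ⁺ⁱ with n > 0, multiplying by Rⁱ on the right
gives e = Fⁿ e = Fⁿ. -/
theorem exists_pow_eq_of_mul_eq {M : Type*} [Monoid M] [Finite M] {e F R : M} (h₂ : F * e = F)
    (h : F * R = e) : ∃ n, 0 < n ∧ F ^ n = e := by
  have hFR : ∀ i, F ^ (i + 1) * R ^ (i + 1) = e := by
    intro i
    induction i with
    | zero => simpa using h
    | succ i ih =>
      rw [pow_succ' F, pow_succ R, mul_assoc, ← mul_assoc _ _ R, ih, ← mul_assoc, h₂, h]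
  have habs : ∀ i, F ^ (i + 1) * e = F ^ (i + 1) := fun i => by rw [pow_succ, mul_assoc, h₂]
  obtain ⟨i, j, hij, hF⟩ := Finite.exists_ne_map_eq_of_infinite fun i : ℕ => F ^ (i + 1)
  wlog hlt : i < j generalizing i j
  · exact this j i hij.symm hF.symm (lt_of_le_of_ne (not_lt.1 hlt) hij.symm)
  obtain ⟨d, rfl⟩ := Nat.exists_eq_add_of_lt hlt
  refine ⟨d + 1, Nat.succ_pos d, ?_⟩
  have : F ^ (i + d + 1 + 1) = F ^ (d + 1) * F ^ (i + 1) := by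
    rw [← pow_add]
    congr 1
    omega
  rw [← habs, ← hFR i, ← mul_assoc, ← this]
  exact congrArg (· * R ^ (i + 1)) hF.symm

/-! ### Pairs of blocks with different slopes over an idempotent -/

section Blocks

variable {α : Type*} {kind : α → LetterKind} {L : Language α}

theorem Context.fst_pow_congr {ρ σ : Context kind} (h : ρ.1.1 = σ.1.1) (n : ℕ) :
    (ρ ^ n).1.1 = (σ ^ n).1.1 := by
  induction n with
  | zero => rfl
  | succ n ih => simp [pow_succ, ih, h]

theorem Context.snd_pow_congr {ρ σ : Context kind} (h : ρ.1.2 = σ.1.2) (n : ℕ) :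
    (ρ ^ n).1.2 = (σ ^ n).1.2 := by
  induction n with
  | zero => rfl
  | succ n ih => simp [pow_succ, ih, h]

theorem Context.height_fst_prod_map {ι : Type*} (C : ι → Context kind) (h : ℤ)
    (hC : ∀ i, height kind (C i).1.1 = h) (I : List ι) :
    height kind (I.map C).prod.1.1 = I.length * h := by
  induction I with
  | nil => simp [height_nil]
  | cons i I ih =>
    rw [List.map_cons, List.prod_cons, mul_fst, height_append, ih, hC]
    push_cast [List.length_cons]
    ring

/-- Two contexts of equal positive height over an idempotent, whose mixtures absorb it. -/
structure BlockPair (kind : α → LetterKind) (L : Language α) (e : SynOps kind L) where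
  block : Bool → Context kind
  ht : ℤ
  ht_pos : 0 < ht
  height_block : ∀ i, height kind (block i).1.1 = ht
  synOp_block : ∀ i, synOp kind L (block i) = e
  absorb : ∀ i j (ρ : Context kind), ρ.1.1 = (block i).1.1 → ρ.1.2 = (block j).1.2 →
    e * synOp kind L ρ = synOp kind L ρ ∧ synOp kind L ρ * e = synOp kind L ρ
  slope_lt : (block false).1.1.length * (block true).1.2.length <
    (block true).1.1.length * (block false).1.2.length

/-- If s and t are the heights of σ and τ, then σᵗ and τˢ both have height st. Each is put between
two copies of σᵗ, so that a mixture begins and ends with a context over `e` and therefore absorbs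
`e`. The sandwich multiplies the determinant of the lengths by three, so the slopes remain
different. Each of the three factors has component lengths at most `B ^ 2`. -/
theorem exists_blockPair {e : SynOps kind L} (he : IsIdempotentElem e) {σ τ : Context kind}
    (hσ : synOp kind L σ = e) (hτ : synOp kind L τ = e) (hσpos : 0 < height kind σ.1.1)
    (hτpos : 0 < height kind τ.1.1) {B : ℕ} (hσB : σ.1.1.length ≤ B ∧ σ.1.2.length ≤ B)
    (hτB : τ.1.1.length ≤ B ∧ τ.1.2.length ≤ B)
    (hne : σ.1.1.length * τ.1.2.length ≠ τ.1.1.length * σ.1.2.length) :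
    ∃ D : BlockPair kind L e, ∀ i,
      (D.block i).1.1.length ≤ 3 * B ^ 2 ∧ (D.block i).1.2.length ≤ 3 * B ^ 2 := by
  obtain ⟨s, -, -, hs⟩ := σ.exists_depth
  obtain ⟨t, -, -, ht⟩ := τ.exists_depth
  have hle : ∀ ρ : Context kind, height kind ρ.1.1 ≤ ρ.1.1.length := fun ρ => by
    have := List.countP_le_length (p := fun a => kind a = .call) (l := ρ.1.1)
    simp only [height]
    omega
  have hsB : s ≤ B := by have := hle σ; omega
  have htB : t ≤ B := by have := hle τ; omega
  have hspos : 0 < s := by omega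
  have htpos : 0 < t := by omega
  have hPpow : ∀ n ≠ 0, e ^ n = e := fun n hn => by
    obtain ⟨n, rfl⟩ := Nat.exists_eq_succ_of_ne_zero hn
    exact he.pow_succ_eq n
  let X : Bool → Context kind := fun i => bif i then τ ^ s else σ ^ t
  have hXP : ∀ i, synOp kind L (X i) = e := by
    rintro (_ | _)
    · simp [X, hσ, hPpow t htpos.ne']
    · simp [X, hτ, hPpow s hspos.ne']
  have hXh : ∀ i, height kind (X i).1.1 = s * t := by
    rintro (_ | _)
    · simp [X, Context.height_fst_pow, hs, mul_comm]
    · simp [X, Context.height_fst_pow, ht]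
  have hXB : ∀ i, (X i).1.1.length ≤ B ^ 2 ∧ (X i).1.2.length ≤ B ^ 2 := by
    rw [pow_two]
    rintro (_ | _)
    · simp only [X, cond_false, Context.length_fst_pow, Context.length_snd_pow]
      exact ⟨Nat.mul_le_mul htB hσB.1, Nat.mul_le_mul htB hσB.2⟩
    · simp only [X, cond_true, Context.length_fst_pow, Context.length_snd_pow]
      exact ⟨Nat.mul_le_mul hsB hτB.1, Nat.mul_le_mul hsB hτB.2⟩
  have hXne : (X false).1.1.length * (X true).1.2.length ≠
      (X true).1.1.length * (X false).1.2.length := by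
    simp only [X, cond_true, cond_false, Context.length_fst_pow, Context.length_snd_pow]
    intro h
    refine hne (Nat.eq_of_mul_eq_mul_left (Nat.mul_pos hspos htpos) ?_)
    linarith
  -- the blocks, up to exchanging them
  have main : ∀ f : Bool → Bool,
      (X false * X (f false) * X false).1.1.length * (X false * X (f true) * X false).1.2.length <
      (X false * X (f true) * X false).1.1.length * (X false * X (f false) * X false).1.2.length →
      ∃ D : BlockPair kind L e, ∀ i,
        (D.block i).1.1.length ≤ 3 * B ^ 2 ∧ (D.block i).1.2.length ≤ 3 * B ^ 2 := by
    intro f hlt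
    refine ⟨⟨fun i => X false * X (f i) * X false, 3 * (s * t), by positivity, fun i => ?_,
      fun i => ?_, fun i j ρ h₁ h₂ => ?_, hlt⟩, fun i => ?_⟩
    · simp only [Context.mul_fst, height_append, hXh]
      ring
    · simp only [map_mul, hXP, he.eq]
    · have hρ : ρ = X false * Context.mix (X (f i)) (X (f j)) ((hXh _).trans (hXh _).symm) *
          X false := Context.ext_parts h₁ h₂
      rw [hρ]
      simp only [map_mul, hXP, ← mul_assoc, he.eq, true_and]
      rw [mul_assoc _ e e, he.eq]
    · have h₁ := hXB false
      have h₂ := hXB (f i)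
      simp only [Context.mul_fst, Context.mul_snd, List.length_append]
      omega
  have hcalc : ∀ f : Bool → Bool, f.Injective →
      (X (f false)).1.1.length * (X (f true)).1.2.length <
      (X (f true)).1.1.length * (X (f false)).1.2.length →
      (X false * X (f false) * X false).1.1.length * (X false * X (f true) * X false).1.2.length <
      (X false * X (f true) * X false).1.1.length * (X false * X (f false) * X false).1.2.length := by
    intro f hf hlt
    simp only [Context.mul_fst, Context.mul_snd, List.length_append]
    have hff : f false = false ∧ f true = true ∨ f false = true ∧ f true = false := by
      have : f false ≠ f true := fun h => by simpa using hf h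
      revert this
      cases f false <;> cases f true <;> simp
    rcases hff with ⟨h₁, h₂⟩ | ⟨h₁, h₂⟩ <;> rw [h₁, h₂] at hlt ⊢ <;> nlinarith
  rcases lt_or_gt_of_ne hXne with h | h
  · exact main id (hcalc id Function.injective_id h)
  · have h' : (X (!false)).1.1.length * (X (!true)).1.2.length <
        (X (!true)).1.1.length * (X (!false)).1.2.length := by simpa using h
    exact main not (hcalc not Bool.not_injective h')

namespace BlockPair

variable {e : SynOps kind L} (D : BlockPair kind L e)

/-- The context of a sequence of blocks. -/
def seq (I : List Bool) : Context kind := (I.map D.block).prod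

theorem height_seq (I : List Bool) : height kind (D.seq I).1.1 = I.length * D.ht :=
  Context.height_fst_prod_map _ _ D.height_block I

theorem synOp_seq (he : IsIdempotentElem e) {I : List Bool} (hI : I ≠ []) :
    synOp kind L (D.seq I) = e := by
  induction I with
  | nil => exact absurd rfl hI
  | cons i I ih =>
    have h : D.seq (i :: I) = D.block i * D.seq I := by simp [seq]
    rw [h, map_mul, D.synOp_block]
    by_cases hI' : I = []
    · simp [hI', seq]
    · rw [ih hI', he.eq]

/-- The mixture of two different blocks is not invertible. -/
theorem pow_ne (he : IsIdempotentElem e)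
    (hr : (synCongruence kind L).quotient.ReachableOp (synImage kind L) e)
    (hweak : IsWeaklyLengthSynchronous kind L) {i j : Bool} (hij : i ≠ j) {ρ : Context kind}
    (h₁ : ρ.1.1 = (D.block i).1.1) (h₂ : ρ.1.2 = (D.block j).1.2) {n : ℕ} (hn : 0 < n) :
    synOp kind L ρ ^ n ≠ e := by
  intro hρ
  have hw := (isWeaklyLengthSynchronous_iff.1 hweak) e he hr
  have hpow : ∀ i, synOp kind L (D.block i ^ n) = e := fun i => by
    obtain ⟨n, rfl⟩ := Nat.exists_eq_succ_of_ne_zero hn.ne'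
    rw [map_pow, D.synOp_block, he.pow_succ_eq]
  have hpos : ∀ i, 0 < height kind (D.block i ^ n).1.1 := fun i => by
    rw [Context.height_fst_pow, D.height_block]
    have := D.ht_pos
    positivity
  have e₁ := Context.fst_pow_congr h₁ n
  have e₂ := Context.snd_pow_congr h₂ n
  rw [← map_pow] at hρ
  have hρpos : 0 < height kind (ρ ^ n).1.1 := e₁ ▸ hpos i
  -- `ρ ^ n` shares its first component with the power of block `i` and its second with the power of
  -- block `j`. So the two blocks have equal lengths on both sides, against `slope_lt`.
  have l₁ := (hw _ _ hρ (hpow i) hρpos (hpos i)).1 e₁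
  have l₂ := (hw _ _ hρ (hpow j) hρpos (hpos j)).2 e₂
  rw [e₂, Context.length_snd_pow, Context.length_snd_pow] at l₁
  rw [e₁, Context.length_fst_pow, Context.length_fst_pow] at l₂
  have l₁ := Nat.eq_of_mul_eq_mul_left hn l₁
  have l₂ := Nat.eq_of_mul_eq_mul_left hn l₂
  have hlt := D.slope_lt
  cases i <;> cases j <;> simp at hij <;> rw [l₁, l₂] at hlt <;> simp at hlt

/-- Blocks are compared from the outside inwards. Equal outer blocks have class `e`, and removing
them reproduces the hypothesis with its factor `e`. Different outer blocks form a mixture with a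
right inverse relative to `e`, so one of its powers would be `e`, which `pow_ne` excludes. -/
theorem eq_of_synOp_eq [Finite (SynOps kind L)] (he : IsIdempotentElem e)
    (hr : (synCongruence kind L).quotient.ReachableOp (synImage kind L) e)
    (hweak : IsWeaklyLengthSynchronous kind L) {I J : List Bool} (hIJ : I.length = J.length)
    {ρ : Context kind} (h₁ : ρ.1.1 = (D.seq I).1.1) (h₂ : ρ.1.2 = (D.seq J).1.2)
    (hρ : e * synOp kind L ρ = e) : I = J := by
  induction I generalizing J ρ with
  | nil => simpa [eq_comm] using hIJ
  | cons i I ih =>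
    obtain _ | ⟨j, J⟩ := J
    · simp at hIJ
    have hlen : I.length = J.length := by simpa using hIJ
    let ρ₀ := Context.mix (D.block i) (D.block j) (by rw [D.height_block, D.height_block])
    let ρ' := Context.mix (D.seq I) (D.seq J) (by rw [D.height_seq, D.height_seq, hlen])
    obtain rfl : ρ = ρ₀ * ρ' := Context.ext_parts h₁ h₂
    have habs := D.absorb i j ρ₀ rfl rfl
    rw [map_mul, ← mul_assoc, habs.1] at hρ
    by_cases hij : i = j
    · subst hij
      have h₀ : synOp kind L ρ₀ = e := D.synOp_block i
      rw [h₀] at hρ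
      rw [ih (ρ := ρ') hlen rfl rfl hρ]
    · obtain ⟨n, hn, hpow⟩ := exists_pow_eq_of_mul_eq habs.2 hρ
      exact absurd hpow (D.pow_ne he hr hweak hij (ρ := ρ₀) rfl rfl hn)

theorem length_seq_replicate (n : ℕ) (i : Bool) :
    (D.seq (List.replicate n i)).1.1.length = n * (D.block i).1.1.length ∧
    (D.seq (List.replicate n i)).1.2.length = n * (D.block i).1.2.length := by
  simp only [seq, List.map_replicate, List.prod_replicate]
  exact ⟨Context.length_fst_pow _ _, Context.length_snd_pow _ _⟩

theorem seq_append (I J : List Bool) : D.seq (I ++ J) = D.seq I * D.seq J := by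
  simp [seq]

theorem seq_flatMap (S : Bool → List Bool) (I : List Bool) :
    D.seq (I.flatMap S) = (I.map fun i => D.seq (S i)).prod := by
  induction I with
  | nil => rfl
  | cons i I ih => simp [seq_append, ih]

end BlockPair

/-! ### From equality of block sequences to membership tests -/

/-- Membership of a context in a syntactic class is recognised by finitely many tests. -/
theorem exists_tests [Finite (SynOps kind L)] {e : SynOps kind L}
    (hr : (synCongruence kind L).quotient.ReachableOp (synImage kind L) e) :
    ∃ T : List (Context kind × WMWord kind × Bool), (∃ t ∈ T, t.2.2 = true) ∧
      ∀ σ : Context kind, synOp kind L σ = e ↔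
        ∀ t ∈ T, (t.1.1.1 ++ (σ.1.1 ++ t.2.1.1 ++ σ.1.2) ++ t.1.1.2 ∈ L ↔ t.2.2 = true) := by
  classical
  have := Fintype.ofFinite (SynOps kind L)
  obtain ⟨σ₀, rfl⟩ := exists_synOp_eq e
  obtain ⟨ρ₀, x₀, h₀⟩ := exists_mem_of_reachableOp hr
  let test : Context kind × WMWord kind → Context kind → Prop := fun t σ =>
    t.1.1.1 ++ (σ.1.1 ++ t.2.1 ++ σ.1.2) ++ t.1.1.2 ∈ L
  have htest : ∀ σ τ, synOp kind L σ = synOp kind L τ ↔ ∀ t, (test t σ ↔ test t τ) := fun σ τ => by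
    rw [synOp_eq_iff_mem]
    exact ⟨fun h t => h t.1 t.2, fun h ρ x => h (ρ, x)⟩
  -- One test for each class `m` suffices, separating it from the class of `σ₀` if they differ. The
  -- test `(ρ₀, x₀)`, provided by reachability, ensures that some expected answer is positive.
  have hsep : ∀ m : SynOps kind L, ∃ t, ∀ τ, synOp kind L τ = m → (test t τ ↔ test t σ₀) →
      synOp kind L τ = synOp kind L σ₀ := by
    intro m
    obtain ⟨τ, rfl⟩ := exists_synOp_eq m
    by_cases hm : synOp kind L τ = synOp kind L σ₀
    · exact ⟨(ρ₀, x₀), fun τ' h _ => h.trans hm⟩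
    · have hm' := hm
      rw [htest] at hm'
      push Not at hm'
      obtain ⟨t, ht⟩ := hm'
      refine ⟨t, fun τ' h h' => absurd ?_ hm⟩
      have := (htest τ' τ).1 h t
      tauto
  choose t ht using hsep
  refine ⟨((ρ₀, x₀) :: (Finset.univ.toList.map t)).map fun t => (t.1, t.2, decide (test t σ₀)),
    ⟨(ρ₀, x₀, decide (test (ρ₀, x₀) σ₀)), by simp, decide_eq_true h₀⟩, fun σ => ?_⟩
  constructor
  · intro h s hs
    obtain ⟨s, -, rfl⟩ := List.mem_map.1 hs
    rw [decide_eq_true_iff]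
    exact (htest _ _).1 h s
  · intro h
    refine ht (synOp kind L σ) σ rfl ?_
    have := h _ (List.mem_map_of_mem (List.mem_cons_of_mem _
      (List.mem_map_of_mem (Finset.mem_toList.2 (Finset.mem_univ (synOp kind L σ))))))
    rwa [decide_eq_true_iff] at this

/-- The first symbol of each code word identifies it, so a sequence can be decoded from the left. -/
theorem flatMap_injective_of_head {S : Bool → List Bool} (hS : ∀ i, (S i).head? = some i) :
    Function.Injective fun I : List Bool => I.flatMap S := by
  intro I J h
  induction I generalizing J with
  | nil =>
    obtain _ | ⟨j, J⟩ := J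
    · rfl
    · have := hS j
      have h' : S j ++ J.flatMap S = [] := by simpa using h.symm
      simp [(List.append_eq_nil_iff.1 h').1] at this
  | cons i I ih =>
    obtain _ | ⟨j, J⟩ := J
    · have := hS i
      have h' : S i ++ I.flatMap S = [] := by simpa using h
      simp [(List.append_eq_nil_iff.1 h').1] at this
    · have h' : S i ++ I.flatMap S = S j ++ J.flatMap S := by simpa using h
      have hij : i = j := by
        have := congrArg List.head? h'
        simpa [List.head?_append, hS] using this
      subst hij
      rw [ih (List.append_cancel_left h')]

/-- Two pairs of words of lengths `(c N, q)` and `(c (N + 1), q)` such that equality of two sequences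
of them is recognised by finitely many membership tests. -/
theorem exists_block_tests [Finite (SynOps kind L)] (hL : ∀ w ∈ L, WellMatched kind w)
    (hweak : IsWeaklyLengthSynchronous kind L) {e : SynOps kind L} (he : IsIdempotentElem e)
    (hr : (synCongruence kind L).quotient.ReachableOp (synImage kind L) e)
    (D : BlockPair kind L e) {N : ℕ} (hN : 0 < N)
    (hDN : (D.block false).1.1.length * (D.block true).1.2.length ≤ N) :
    ∃ (c q : ℕ) (A B : Bool → List α) (T : List (List α × List α × List α × Bool)),
      (A false).length = N * c ∧ (A true).length = (N + 1) * c ∧ (∀ i, (B i).length = q) ∧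
      ∀ I J : List Bool, I = J ↔ ∀ t ∈ T,
        (t.1 ++ I.flatMap A ++ t.2.1 ++ J.reverse.flatMap B ++ t.2.2.1 ∈ L ↔ t.2.2.2 = true) := by
  obtain ⟨T, ⟨t₀, ht₀, ht₀'⟩, hT⟩ := exists_tests hr
  have hpos₁ := Context.length_pos_of_height_pos (σ := D.block false)
    (by rw [D.height_block]; exact D.ht_pos)
  obtain ⟨d, hd⟩ := Nat.exists_eq_add_of_lt D.slope_lt
  set p₁ := (D.block false).1.1.length
  set q₁ := (D.block false).1.2.length
  set p₂ := (D.block true).1.1.length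
  set q₂ := (D.block true).1.2.length
  -- Here `d + 1` is the determinant p₂q₁ - p₁q₂ and x = N(d+1) - p₁q₂; the lower bound for `N` is
  -- what makes this subtraction possible.
  obtain ⟨x, hx⟩ := Nat.exists_eq_add_of_le (hDN.trans (Nat.le_mul_of_pos_right N d.succ_pos))
  rw [Nat.succ_eq_add_one] at hx
  -- The right lengths are N(d+1)q₁ for both sequences. The left lengths are N(d+1)p₁ for `false`
  -- and p₁(p₂q₁ + x) = (N+1)(d+1)p₁ for `true`.
  let S : Bool → List Bool := fun i =>
    bif i then List.replicate (p₁ * q₁) true ++ List.replicate x false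
    else List.replicate (N * (d + 1)) false
  have hS : ∀ i, (S i).head? = some i := by
    rintro (_ | _)
    · simp [S, List.head?_replicate, hN.ne']
    · simp [S, List.head?_append, List.head?_replicate, hpos₁.1.ne', hpos₁.2.ne']
  have hA : ∀ I : List Bool, (D.seq (I.flatMap S)).1.1 = I.flatMap fun i => (D.seq (S i)).1.1 := by
    intro I
    rw [D.seq_flatMap, Context.prod_fst, List.flatMap_map]
  have hB : ∀ I : List Bool,
      (D.seq (I.flatMap S)).1.2 = I.reverse.flatMap fun i => (D.seq (S i)).1.2 := by
    intro I
    rw [D.seq_flatMap, Context.prod_snd, ← List.map_reverse, List.flatMap_map]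
  refine ⟨(d + 1) * p₁, N * (d + 1) * q₁, fun i => (D.seq (S i)).1.1, fun i => (D.seq (S i)).1.2,
    
    -- An additional block outside the sequences makes the tests speak of `e` times the class of the
    -- mixture, which also takes care of the empty sequence.
    T.map fun t => (t.1.1.1 ++ (D.block false).1.1, t.2.1.1, (D.block false).1.2 ++ t.1.1.2, t.2.2), ?_, ?_, ?_,
    fun I J => ?_⟩
  · change (D.seq (List.replicate _ _)).1.1.length = _
    rw [(D.length_seq_replicate _ _).1, mul_assoc]
  · change (D.seq (List.replicate _ _ ++ List.replicate _ _)).1.1.length = _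
    rw [D.seq_append, Context.mul_fst, List.length_append, (D.length_seq_replicate _ _).1,
      (D.length_seq_replicate _ _).1]
    change p₁ * q₁ * p₂ + x * p₁ = _
    have : p₁ * q₁ * p₂ + x * p₁ = p₁ * (p₂ * q₁ + x) := by ring
    rw [this, hd]
    have : p₁ * (p₁ * q₂ + d + 1 + x) = p₁ * ((p₁ * q₂ + x) + (d + 1)) := by ring
    rw [this, ← hx]
    ring
  · rintro (_ | _)
    · change (D.seq (List.replicate _ _)).1.2.length = _
      exact (D.length_seq_replicate _ _).2
    · change (D.seq (List.replicate _ _ ++ List.replicate _ _)).1.2.length = _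
      rw [D.seq_append, Context.mul_snd, List.length_append, (D.length_seq_replicate _ _).2,
        (D.length_seq_replicate _ _).2]
      change x * q₁ + p₁ * q₁ * q₂ = _
      rw [hx]
      ring
  · simp only [List.forall_mem_map, ← hA, ← hB]
    have hassoc : ∀ s d u x v d' t : List α,
        s ++ d ++ u ++ x ++ v ++ (d' ++ t) = s ++ ((d ++ u) ++ x ++ (v ++ d')) ++ t := by
      intros
      simp
    simp only [hassoc]
    constructor
    · rintro rfl
      refine (hT (D.block false * D.seq (I.flatMap S))).1 ?_
      rw [map_mul, D.synOp_block]
      by_cases hI : I.flatMap S = []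
      · simp [hI, BlockPair.seq]
      · rw [D.synOp_seq he hI, he.eq]
    · intro h
      refine flatMap_injective_of_head hS ?_
      by_cases hlen : (I.flatMap S).length = (J.flatMap S).length
      · let ρ := Context.mix (D.seq (I.flatMap S)) (D.seq (J.flatMap S))
          (by rw [D.height_seq, D.height_seq, hlen])
        refine D.eq_of_synOp_eq he hr hweak hlen (ρ := ρ) rfl rfl ?_
        rw [← D.synOp_block false, ← map_mul, D.synOp_block]
        exact (hT (D.block false * ρ)).2 h
      · exfalso
        -- A positive answer makes the tested word well-matched, hence of height zero. As the blocks
        -- have a common positive height, the two sequences have the same length.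
        have hmem := hL _ ((h t₀ ht₀).2 ht₀')
        have h₀ := eq_add_height_of_depth (hmem.depth_eq 0)
        have h₁ := eq_add_height_of_depth (t₀.2.1.2.depth_eq 0)
        have h₂ := t₀.1.height_snd
        have h₃ := (D.seq (J.flatMap S)).height_snd
        have h₅ := (D.block false).height_snd
        simp only [height_append, h₂, h₃, h₅, D.height_seq] at h₀
        have h₄ : (((I.flatMap S).length : ℤ) - (J.flatMap S).length) * D.ht = 0 := by
          push_cast at h₀ h₁
          linarith
        rcases mul_eq_zero.1 h₄ with h₄ | h₄
        · omega
        · exact D.ht_pos.ne' h₄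

end Blocks

/-! ### The words of `𝓛_{k,l}` -/

/-- The words `ac^{k-1}` and `ac^{l-1}`. -/
def blockKL (k l : ℕ) (i : Bool) : List ABC :=
  .a :: List.replicate ((bif i then l else k) - 1) .c

/-- The letters `b₁` and `b₂`. -/
def letterKL (i : Bool) : ABC := bif i then .b₂ else .b₁

theorem append_nonterminal_inj {T N : Type*} {X : List T} {Y : List T} {n n' : N}
    {p q : List (Symbol T N)}
    (h : X.map .terminal ++ .nonterminal n :: Y.map .terminal = p ++ .nonterminal n' :: q) :
    p = X.map .terminal ∧ q = Y.map .terminal := by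
  induction X generalizing p with
  | nil =>
    obtain _ | ⟨s, p⟩ := p
    · simp only [List.map_nil, List.nil_append, List.cons.injEq] at h ⊢
      exact ⟨trivial, h.2.symm⟩
    · have h' : Symbol.nonterminal n' ∈ Y.map (Symbol.terminal (N := N)) := by
        have := (List.cons.inj h).2
        rw [this]
        simp
      simp at h'
  | cons x X ih =>
    obtain _ | ⟨s, p⟩ := p
    · simp at h
    · simp only [List.map_cons, List.cons_append, List.cons.injEq] at h ⊢
      obtain ⟨rfl, h⟩ := h
      obtain ⟨rfl, rfl⟩ := ih h
      simp

theorem mem_rulesKL {k l : ℕ} {r : ContextFreeRule ABC Unit} : r ∈ rulesKL k l ↔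
    r = ⟨(), .terminal .a :: (List.replicate (k - 1) (.terminal .c) ++
        [.nonterminal (), .terminal .b₁])⟩ ∨
    r = ⟨(), .terminal .a :: (List.replicate (l - 1) (.terminal .c) ++
        [.nonterminal (), .terminal .b₂])⟩ ∨ r = ⟨(), []⟩ := by
  simp [rulesKL]

theorem exists_sentence_of_rewrites {k l : ℕ} {r : ContextFreeRule ABC Unit}
    (hr : r ∈ rulesKL k l) {I : List Bool} {s : List (Symbol ABC Unit)}
    (hs : r.Rewrites ((I.flatMap (blockKL k l)).map .terminal ++
      .nonterminal () :: (I.reverse.map letterKL).map .terminal) s) :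
    ∃ I : List Bool,
      s = (I.flatMap (blockKL k l)).map .terminal ++
        .nonterminal () :: (I.reverse.map letterKL).map .terminal ∨
      s = (I.flatMap (blockKL k l)).map .terminal ++ (I.reverse.map letterKL).map .terminal := by
  obtain ⟨p, q, hp, rfl⟩ := hs.exists_parts
  obtain ⟨rfl, rfl⟩ := append_nonterminal_inj (hp.trans (by simp; rfl))
  rcases mem_rulesKL.1 hr with rfl | rfl | rfl
  · exact ⟨I ++ [false], .inl (by simp [blockKL, letterKL])⟩
  · exact ⟨I ++ [true], .inl (by simp [blockKL, letterKL])⟩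
  · exact ⟨I, .inr (by simp)⟩

/-- The grammar is linear: a sentential form consists of blocks, at most one nonterminal, and the
corresponding letters in reverse order. -/
theorem mem_langKL_iff {k l : ℕ} {w : List ABC} :
    w ∈ langKL k l ↔ ∃ I : List Bool, w = I.flatMap (blockKL k l) ++ I.reverse.map letterKL := by
  constructor
  · intro h
    have key : ∀ s, (grammarKL k l).Derives [.nonterminal ()] s → ∃ I : List Bool,
        s = (I.flatMap (blockKL k l)).map .terminal ++
          .nonterminal () :: (I.reverse.map letterKL).map .terminal ∨
        s = (I.flatMap (blockKL k l)).map .terminal ++ (I.reverse.map letterKL).map .terminal := by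
      intro s hs
      induction hs with
      | refl => exact ⟨[], .inl rfl⟩
      | tail _ hstep ih =>
        obtain ⟨r, hr, hstep⟩ := hstep
        have ⟨p, q, hp, _⟩ := hstep.exists_parts
        obtain ⟨I, rfl | rfl⟩ := ih
        · exact exists_sentence_of_rewrites hr hstep
        · have : Symbol.nonterminal r.input ∈ p ++ [.nonterminal r.input] ++ q := by simp
          rw [← hp] at this
          simp at this
    obtain ⟨I, hI | hI⟩ := key _ h
    · have : Symbol.nonterminal () ∈ w.map (Symbol.terminal (N := Unit)) := by
        have h' : w.map (Symbol.terminal (N := Unit)) = _ := hI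
        rw [h']
        exact List.mem_append_right _ List.mem_cons_self
      simp at this
    · refine ⟨I, ?_⟩
      rw [← List.map_append] at hI
      exact List.map_injective_iff.2 (fun _ _ h => by simpa using h) hI
  · rintro ⟨I, rfl⟩
    have key : ∀ I : List Bool, (grammarKL k l).Derives [.nonterminal ()]
        ((I.flatMap (blockKL k l)).map .terminal ++
          ([.nonterminal ()] ++ (I.reverse.map letterKL).map .terminal)) := by
      intro I
      induction I with
      | nil => exact Relation.ReflTransGen.refl
      | cons i I ih =>
        have hprod : (grammarKL k l).Produces [.nonterminal ()]
            ((blockKL k l i).map .terminal ++ [.nonterminal ()] ++ [.terminal (letterKL i)]) := by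
          cases i
          · refine ⟨_, mem_rulesKL.2 (.inl rfl), ?_⟩
            convert ContextFreeRule.Rewrites.head (r := ⟨(), _⟩) [] using 1
            simp [blockKL, letterKL]
            rfl
          · refine ⟨_, mem_rulesKL.2 (.inr (.inl rfl)), ?_⟩
            convert ContextFreeRule.Rewrites.head (r := ⟨(), _⟩) [] using 1
            simp [blockKL, letterKL]
            rfl
        refine hprod.single.trans ?_
        have := (ih.append_left ((blockKL k l i).map .terminal)).append_right
          [.terminal (letterKL i)]
        simpa using this
    have hnil : (grammarKL k l).Produces [.nonterminal ()] [] :=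
      ⟨⟨(), []⟩, mem_rulesKL.2 (.inr (.inr rfl)), ContextFreeRule.Rewrites.input_output⟩
    have := (hnil.append_right ((I.reverse.map letterKL).map .terminal)).append_left
      ((I.flatMap (blockKL k l)).map .terminal)
    rw [List.nil_append, ← List.map_append] at this
    exact (key I).trans_produces this

/-! ### Building circuits -/

open Classical in
/-- The value of a gate, given the values of the earlier gates. -/
noncomputable def Gate.value {n i : ℕ} (B : Language Bool) (x : Fin n → Bool) (v : ℕ → Bool) :
    Gate n i → Bool
  | .input j => x j
  | .not j => !v j
  | .and js => (js.map fun j => v j.1).all id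
  | .or js => (js.map fun j => v j.1).any id
  | .oracle js => decide ((js.map fun j => v j.1) ∈ B)

theorem Gate.value_congr {n i : ℕ} (B : Language Bool) (x : Fin n → Bool) {v v' : ℕ → Bool}
    (h : ∀ j < i, v j = v' j) (g : Gate n i) : g.value B x v = g.value B x v' := by
  have hmap : ∀ js : List (Fin i), (js.map fun j => v j.1) = js.map fun j => v' j.1 := fun js =>
    List.map_congr_left fun j _ => h j.1 j.2
  cases g with
  | input j => rfl
  | not j => simp only [value, h j.1 j.2]
  | and js => simp only [value, hmap]
  | or js => simp only [value, hmap]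
  | oracle js => exact decide_eq_decide.2 (by rw [hmap])

/-- Circuits without a distinguished output, with the values and upper bounds for the depths of
their gates, and a set of gates containing the oracle gates and everything reachable from them. -/
structure PartialCircuit (n : ℕ) (B : Language Bool) (D q : ℕ) where
  size : ℕ
  -- These functions are total, with irrelevant values from `size` on, so that a gate can be added
  -- by `Function.update`.
  gate : (i : ℕ) → Gate n i
  val : ℕ → (Fin n → Bool) → Bool
  dep : ℕ → ℕ
  late : ℕ → Prop
  val_eq : ∀ i < size, ∀ x, val i x = (gate i).value B x fun j => val j x
  dep_lt : ∀ i < size, ∀ j ∈ (gate i).args, dep j.1 < dep i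
  dep_le : ∀ i < size, dep i ≤ D
  oracle : ∀ i < size, (gate i).IsOracle →
    (gate i).args.length ≤ q ∧ (∀ j ∈ (gate i).args, ¬ late j.1) ∧ late i
  late_of_late : ∀ i < size, ∀ j ∈ (gate i).args, late j.1 → late i

namespace PartialCircuit

variable {n : ℕ} {B : Language Bool} {D q : ℕ}

theorem exists_circuit (C : PartialCircuit n B D q) {o : ℕ} (ho : o < C.size) :
    ∃ C' : Circuit n, C'.size = C.size ∧ (∀ x, C'.eval B x C'.output = C.val o x) ∧
      (∀ i, C'.depthAt i ≤ D) ∧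
      (∀ i, (C'.gate i).IsOracle → (C'.gate i).args.length ≤ q) ∧
      (∀ i j, (C'.gate i).IsOracle → (C'.gate j).IsOracle →
        ¬ Relation.TransGen C'.Wire i j) := by
  let C' : Circuit n := ⟨C.size, fun i => C.gate i.1, ⟨o, ho⟩⟩
  have heval : ∀ x i (hi : i < C.size), C'.eval B x ⟨i, hi⟩ = C.val i x := by
    intro x i
    induction i using Nat.strong_induction_on with | _ i ih
    intro hi
    have hmap : ∀ js : List (Fin i),
        (js.map fun j => C'.eval B x ⟨j.1, j.2.trans hi⟩) = js.map fun j => C.val j.1 x :=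
      fun js => List.map_congr_left fun j _ => ih j.1 j.2 _
    rw [C.val_eq i hi, Circuit.eval]
    have hg : C'.gate ⟨i, hi⟩ = C.gate i := rfl
    rw [hg]
    cases C.gate i with
    | input j => rfl
    | not j => simp only [Gate.value, ih j.1 j.2]
    | and js => simp only [Gate.value, hmap]
    | or js => simp only [Gate.value, hmap]
    | oracle js => exact decide_eq_decide.2 (by rw [hmap])
  have hdepth : ∀ i (hi : i < C.size), C'.depthAt ⟨i, hi⟩ ≤ C.dep i := by
    intro i
    induction i using Nat.strong_induction_on with | _ i ih
    intro hi
    rw [Circuit.depthAt]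
    have : ∀ l : List (Fin i), (∀ j ∈ l, C.dep j.1 < C.dep i) →
        (l.map fun j => C'.depthAt ⟨j.1, j.2.trans hi⟩ + 1).foldr max 0 ≤ C.dep i := by
      intro l hl
      induction l with
      | nil => simp
      | cons j l ihl =>
        simp only [List.map_cons, List.foldr_cons, max_le_iff]
        exact ⟨(Nat.succ_le_succ (ih j.1 j.2 _)).trans (hl j (by simp)),
          ihl fun j hj => hl j (by simp [hj])⟩
    exact this _ (C.dep_lt i hi)
  refine ⟨C', rfl, fun x => heval x o ho, fun i => (hdepth i.1 i.2).trans (C.dep_le i.1 i.2),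
    fun i hi => (C.oracle i.1 i.2 hi).1, fun i j hi hj hij => ?_⟩
  -- A gate reached from an oracle gate has a late argument, whereas oracle gates have none.
  have hlate : ∀ j, Relation.TransGen C'.Wire i j → C.late j.1 ∧
      ∃ k : Fin j.1, k ∈ (C.gate j.1).args ∧ C.late k.1 := by
    intro j hij
    induction hij with
    | single h =>
      obtain ⟨h₁, h₂⟩ := h
      have hl := (C.oracle i.1 i.2 hi).2.2
      exact ⟨C.late_of_late _ (Fin.is_lt _) _ h₂ hl, _, h₂, hl⟩
    | tail _ h ih =>
      obtain ⟨h₁, h₂⟩ := h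
      exact ⟨C.late_of_late _ (Fin.is_lt _) _ h₂ ih.1, _, h₂, ih.1⟩
  obtain ⟨-, k, hk, hk'⟩ := hlate j hij
  exact (C.oracle j.1 j.2 hj).2.1 k hk hk'

/-- The empty circuit. -/
def empty : PartialCircuit n B D q where
  size := 0
  gate _ := .and []
  val _ _ := true
  dep _ := 0
  late _ := False
  val_eq _ h := absurd h (Nat.not_lt_zero _)
  dep_lt _ h := absurd h (Nat.not_lt_zero _)
  dep_le _ h := absurd h (Nat.not_lt_zero _)
  oracle _ h := absurd h (Nat.not_lt_zero _)
  late_of_late _ h := absurd h (Nat.not_lt_zero _)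

/-- `C'` extends `C`. -/
structure Extends (C' C : PartialCircuit n B D q) : Prop where
  size_le : C.size ≤ C'.size
  val : ∀ i < C.size, C'.val i = C.val i
  dep : ∀ i < C.size, C'.dep i = C.dep i
  late : ∀ i < C.size, (C'.late i ↔ C.late i)

theorem Extends.refl (C : PartialCircuit n B D q) : C.Extends C :=
  ⟨le_rfl, fun _ _ => rfl, fun _ _ => rfl, fun _ _ => Iff.rfl⟩

theorem Extends.trans {C'' C' C : PartialCircuit n B D q} (h' : C''.Extends C')
    (h : C'.Extends C) : C''.Extends C :=
  ⟨h.size_le.trans h'.size_le,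
    fun i hi => (h'.val i (hi.trans_le h.size_le)).trans (h.val i hi),
    fun i hi => (h'.dep i (hi.trans_le h.size_le)).trans (h.dep i hi),
    fun i hi => (h'.late i (hi.trans_le h.size_le)).trans (h.late i hi)⟩

theorem exists_add_gate (C : PartialCircuit n B D q) (g : Gate n C.size) (d : ℕ) (late : Prop)
    (hd : d ≤ D) (hdep : ∀ j ∈ g.args, C.dep j.1 < d)
    (horacle : g.IsOracle → g.args.length ≤ q ∧ (∀ j ∈ g.args, ¬ C.late j.1) ∧ late)
    (hlate : ∀ j ∈ g.args, C.late j.1 → late) :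
    ∃ C' : PartialCircuit n B D q, C'.Extends C ∧ C'.size = C.size + 1 ∧
      (C'.val C.size = fun x => g.value B x fun j => C.val j x) ∧ C'.dep C.size = d ∧
      (C'.late C.size ↔ late) := by
  let gate' : (i : ℕ) → Gate n i := Function.update C.gate C.size g
  let val' := Function.update C.val C.size fun x => g.value B x fun j => C.val j x
  let dep' := Function.update C.dep C.size d
  let late' := Function.update C.late C.size late
  have hgate : ∀ i < C.size, gate' i = C.gate i := fun i hi => Function.update_of_ne hi.ne _ _
  have hval : ∀ i < C.size, val' i = C.val i := fun i hi => Function.update_of_ne hi.ne _ _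
  have hdep' : ∀ i < C.size, dep' i = C.dep i := fun i hi => Function.update_of_ne hi.ne _ _
  have hlate' : ∀ i < C.size, late' i = C.late i := fun i hi => Function.update_of_ne hi.ne _ _
  have hgate₀ : gate' C.size = g := Function.update_self _ _ _
  have hval₀ : val' C.size = fun x => g.value B x fun j => C.val j x := Function.update_self _ _ _
  have hdep₀ : dep' C.size = d := Function.update_self _ _ _
  have hlate₀ : late' C.size = late := Function.update_self _ _ _
  refine ⟨⟨C.size + 1, gate', val', dep', late', ?_, ?_, ?_, ?_, ?_⟩,
    ⟨Nat.le_succ _, hval, hdep', fun i hi => (hlate' i hi).to_iff⟩, rfl, hval₀, hdep₀,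
    hlate₀.to_iff⟩
  · intro i hi x
    rcases Nat.lt_succ_iff_lt_or_eq.1 hi with hi | rfl
    · rw [hval i hi, hgate i hi, C.val_eq i hi]
      exact Gate.value_congr B x (fun j hj => (congrFun (hval j (hj.trans hi)) x).symm) _
    · rw [hval₀, hgate₀]
      exact Gate.value_congr B x (fun j hj => (congrFun (hval j hj) x).symm) _
  · intro i hi
    rcases Nat.lt_succ_iff_lt_or_eq.1 hi with hi | rfl
    · rw [hgate i hi, hdep' i hi]
      intro j hj
      rw [hdep' j (j.2.trans hi)]
      exact C.dep_lt i hi j hj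
    · rw [hgate₀, hdep₀]
      intro j hj
      rw [hdep' j j.2]
      exact hdep j hj
  · intro i hi
    rcases Nat.lt_succ_iff_lt_or_eq.1 hi with hi | rfl
    · rw [hdep' i hi]
      exact C.dep_le i hi
    · rwa [hdep₀]
  · intro i hi
    rcases Nat.lt_succ_iff_lt_or_eq.1 hi with hi | rfl
    · rw [hgate i hi, hlate' i hi]
      intro ho
      obtain ⟨h₁, h₂, h₃⟩ := C.oracle i hi ho
      exact ⟨h₁, fun j hj => by rw [hlate' j (j.2.trans hi)]; exact h₂ j hj, h₃⟩
    · rw [hgate₀, hlate₀]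
      intro ho
      obtain ⟨h₁, h₂, h₃⟩ := horacle ho
      exact ⟨h₁, fun j hj => by rw [hlate' j j.2]; exact h₂ j hj, h₃⟩
  · intro i hi
    rcases Nat.lt_succ_iff_lt_or_eq.1 hi with hi | rfl
    · rw [hgate i hi, hlate' i hi]
      intro j hj
      rw [hlate' j (j.2.trans hi)]
      exact C.late_of_late i hi j hj
    · rw [hgate₀, hlate₀]
      intro j hj
      rw [hlate' j j.2]
      exact hlate j hj

end PartialCircuit

/-- Every circuit can be extended by at most `c` gates to one that computes `f` at depth at most
`d`, and not behind an oracle gate if `early` holds. -/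
def Buildable {n : ℕ} (B : Language Bool) (D q : ℕ) (early : Prop) (d c : ℕ)
    (f : (Fin n → Bool) → Bool) : Prop :=
  ∀ C : PartialCircuit n B D q, ∃ C' : PartialCircuit n B D q, C'.Extends C ∧
    C'.size ≤ C.size + c ∧ ∃ i < C'.size, C'.val i = f ∧ C'.dep i ≤ d ∧ (early → ¬ C'.late i)

namespace Buildable

variable {n : ℕ} {B : Language Bool} {D q : ℕ} {early : Prop} {d c : ℕ}
  {f : (Fin n → Bool) → Bool} {fs : List ((Fin n → Bool) → Bool)}

theorem mono (h : Buildable B D q early d c f) {early' : Prop} {d' c' : ℕ}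
    (he : early' → early) (hd : d ≤ d') (hc : c ≤ c') : Buildable B D q early' d' c' f := by
  intro C
  obtain ⟨C', h₁, h₂, i, h₃, h₄, h₅, h₆⟩ := h C
  exact ⟨C', h₁, h₂.trans (by omega), i, h₃, h₄, h₅.trans hd, fun h => h₆ (he h)⟩

/-- The functions are built one after another without sharing gates, so their costs add up. -/
theorem exists_list (h : ∀ f ∈ fs, Buildable B D q early d c f) (C : PartialCircuit n B D q) :
    ∃ C' : PartialCircuit n B D q, C'.Extends C ∧ C'.size ≤ C.size + fs.length * c ∧
      ∃ js : List (Fin C'.size), (js.map fun j => C'.val j.1) = fs ∧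
        ∀ j ∈ js, C'.dep j.1 ≤ d ∧ (early → ¬ C'.late j.1) := by
  induction fs generalizing C with
  | nil => exact ⟨C, .refl C, by simp, [], rfl, by simp⟩
  | cons f fs ih =>
    obtain ⟨C₁, h₁, h₂, i, hi, h₃, h₄, h₅⟩ := h f (by simp) C
    obtain ⟨C₂, h₁', h₂', js, h₃', h₄'⟩ := ih (fun f hf => h f (by simp [hf])) C₁
    refine ⟨C₂, h₁'.trans h₁, ?_, ⟨i, hi.trans_le h₁'.size_le⟩ :: js, ?_, ?_⟩
    · simp only [List.length_cons, add_mul]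
      omega
    · simp only [List.map_cons, h₃', h₁'.val i hi, h₃]
    · intro j hj
      rcases List.mem_cons.1 hj with rfl | hj
      · exact ⟨(h₁'.dep i hi).trans_le h₄, fun he => by rw [h₁'.late i hi]; exact h₅ he⟩
      · exact h₄' j hj

/-- Adding a gate fed by buildable functions. -/
theorem add_gate (h : ∀ f ∈ fs, Buildable B D q early d c f) (hd : d + 1 ≤ D)
    (g : {s : ℕ} → List (Fin s) → Gate n s) (hargs : ∀ s (js : List (Fin s)), (g js).args = js)
    (late : Prop) (hlate : late ∨ early)
    (horacle : ∀ s (js : List (Fin s)), (g js).IsOracle → fs.length ≤ q ∧ early ∧ late)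
    (F : (Fin n → Bool) → Bool)
    (hF : ∀ s (js : List (Fin s)) (v : ℕ → (Fin n → Bool) → Bool),
      (js.map fun j => v j.1) = fs → ∀ x, (g js).value B x (fun j => v j x) = F x) :
    Buildable B D q (¬ late) (d + 1) (fs.length * c + 1) F := by
  intro C
  obtain ⟨C₁, h₁, h₂, js, h₃, h₄⟩ := exists_list h C
  have hlen : js.length = fs.length := by rw [← h₃, List.length_map]
  obtain ⟨C₂, e₁, e₂, e₃, e₄, e₅⟩ := C₁.exists_add_gate (g js) (d + 1) late hd
    (by rw [hargs]; exact fun j hj => Nat.lt_succ_of_le (h₄ j hj).1)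
    (by
      rw [hargs]
      intro ho
      obtain ⟨o₁, o₂, o₃⟩ := horacle _ js ho
      exact ⟨hlen.trans_le o₁, fun j hj => (h₄ j hj).2 o₂, o₃⟩)
    (by
      rw [hargs]
      intro j hj hl
      rcases hlate with hlate | he
      · exact hlate
      · exact absurd hl ((h₄ j hj).2 he))
  refine ⟨C₂, e₁.trans h₁, by omega, C₁.size, by omega, ?_, e₄.le, fun h => by rwa [e₅]⟩
  rw [e₃]
  exact funext fun x => hF _ js C₁.val h₃ x

theorem input (j : Fin n) : Buildable B D q True 0 1 fun x => x j := by
  intro C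
  obtain ⟨C', h₁, h₂, h₃, h₄, h₅⟩ := C.exists_add_gate (.input j) 0 False (Nat.zero_le _)
    (by simp [Gate.args]) (by simp [Gate.IsOracle]) (by simp [Gate.args])
  exact ⟨C', h₁, h₂.le, C.size, by omega, h₃, h₄.le, fun _ => by rw [h₅]; exact id⟩

theorem not (h : Buildable B D q early d c f) (hd : d + 1 ≤ D) :
    Buildable B D q early (d + 1) (c + 1) fun x => !f x := by
  intro C
  obtain ⟨C₁, h₁, h₂, i, hi, h₃, h₄, h₅⟩ := h C
  obtain ⟨C₂, e₁, e₂, e₃, e₄, e₅⟩ := C₁.exists_add_gate (.not ⟨i, hi⟩) (d + 1) (C₁.late i) hd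
    (by simpa [Gate.args] using Nat.lt_succ_of_le h₄) (by simp [Gate.IsOracle])
    (by simp [Gate.args])
  refine ⟨C₂, e₁.trans h₁, by omega, C₁.size, by omega, ?_, e₄.le, fun h => by rw [e₅]; exact h₅ h⟩
  rw [e₃]
  simp [Gate.value, h₃]

theorem map_val {s : ℕ} {js : List (Fin s)} {v : ℕ → (Fin n → Bool) → Bool}
    (h : (js.map fun j => v j.1) = fs) (x : Fin n → Bool) :
    (js.map fun j => v j.1 x) = fs.map fun f => f x := by
  rw [← h, List.map_map]
  rfl

theorem all (h : ∀ f ∈ fs, Buildable B D q early d c f) (hd : d + 1 ≤ D) :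
    Buildable B D q early (d + 1) (fs.length * c + 1) fun x => fs.all fun f => f x := by
  refine (add_gate h hd .and (fun _ _ => rfl) (¬ early) (Classical.em _).symm
    (fun _ _ h => h.elim) _ fun s js v hv x => ?_).mono (fun h => not_not.2 h) le_rfl le_rfl
  simp only [Gate.value, map_val hv, List.all_map]
  rfl

theorem any (h : ∀ f ∈ fs, Buildable B D q early d c f) (hd : d + 1 ≤ D) :
    Buildable B D q early (d + 1) (fs.length * c + 1) fun x => fs.any fun f => f x := by
  refine (add_gate h hd .or (fun _ _ => rfl) (¬ early) (Classical.em _).symm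
    (fun _ _ h => h.elim) _ fun s js v hv x => ?_).mono (fun h => not_not.2 h) le_rfl le_rfl
  simp only [Gate.value, map_val hv, List.any_map]
  rfl

open Classical in
theorem oracle (h : ∀ f ∈ fs, Buildable B D q True d c f) (hd : d + 1 ≤ D) (hq : fs.length ≤ q) :
    Buildable B D q False (d + 1) (fs.length * c + 1)
      fun x => decide ((fs.map fun f => f x) ∈ B) := by
  refine (add_gate h hd .oracle (fun _ _ => rfl) True (.inl trivial)
    (fun _ _ _ => ⟨hq, trivial, trivial⟩) _ fun s js v hv x => ?_).mono (fun h => h.elim)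
    le_rfl le_rfl
  simp only [Gate.value, map_val hv]

end Buildable

/-! ### Local functions -/

/-- `f` depends on at most `W` coordinates. -/
def IsJunta {n : ℕ} (W : ℕ) (f : (Fin n → Bool) → Bool) : Prop :=
  ∃ S : Finset (Fin n), S.card ≤ W ∧ ∀ x y, (∀ i ∈ S, x i = y i) → f x = f y

/-- A bound for the number of gates computing a function of `W` variables. -/
def juntaCost (W : ℕ) : ℕ := 2 ^ W * (W * 2 + 1) + 1

/-- Disjunctive normal form: one term for each satisfying assignment of the relevant coordinates,
given by the set `A` of true ones. There are at most `2 ^ W` terms of at most `W` literals, and a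
literal needs at most two gates. -/
theorem IsJunta.buildable {n W : ℕ} {f : (Fin n → Bool) → Bool} (hf : IsJunta W f)
    (B : Language Bool) {D : ℕ} (q : ℕ) (hD : 3 ≤ D) :
    Buildable B D q True 3 (juntaCost W) f := by
  classical
  obtain ⟨S, hS, hfS⟩ := hf
  let lit : Finset (Fin n) → Fin n → (Fin n → Bool) → Bool := fun A i x =>
    if i ∈ A then x i else !x i
  have hlit : ∀ A i, Buildable B D q True 1 2 (lit A i) := by
    intro A i
    by_cases hi : i ∈ A
    · simp only [lit, hi, if_true]
      exact (Buildable.input i).mono id (by omega) (by omega)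
    · simp only [lit, hi, if_false]
      exact (Buildable.input i).not (by omega)
  let term : Finset (Fin n) → (Fin n → Bool) → Bool := fun A x =>
    (S.toList.map (lit A)).all fun g => g x
  have hterm : ∀ A, Buildable B D q True 2 (W * 2 + 1) (term A) := fun A =>
    (Buildable.all (fs := S.toList.map (lit A)) (c := 2) (d := 1)
      (by simpa using fun i _ => hlit A i) (by omega)).mono id le_rfl (by simpa using hS)
  let sets := (S.powerset.filter fun A => f fun i => decide (i ∈ A)).toList
  have hsets : sets.length ≤ 2 ^ W := by
    rw [Finset.length_toList]
    refine (Finset.card_filter_le _ _).trans ?_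
    rw [Finset.card_powerset]
    exact Nat.pow_le_pow_right (by norm_num) hS
  have hany := (Buildable.any (fs := sets.map term) (c := W * 2 + 1) (d := 2)
    (by simpa using fun A _ => hterm A) (by omega)).mono (c' := juntaCost W) id le_rfl
    (Nat.succ_le_succ (Nat.mul_le_mul_right _ (by simpa using hsets)))
  convert hany using 1
  funext x
  have hiff : ∀ A ⊆ S, (term A x = true ↔ ∀ i ∈ S, (x i = decide (i ∈ A))) := by
    intro A _
    simp only [term, List.all_map, List.all_eq_true, Finset.mem_toList]
    refine forall₂_congr fun i _ => ?_
    by_cases hi : i ∈ A <;> simp [lit, hi]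
  rw [Bool.eq_iff_iff, List.any_map, List.any_eq_true]
  constructor
  · intro hx
    refine ⟨S.filter fun i => x i = true, ?_, ?_⟩
    · rw [Finset.mem_toList, Finset.mem_filter]
      refine ⟨Finset.mem_powerset.2 (Finset.filter_subset _ _), ?_⟩
      refine (hfS _ _ fun i hi => ?_).trans hx
      simp [hi]
    · refine (hiff _ (Finset.filter_subset _ _)).2 fun i hi => ?_
      simp [hi]
  · rintro ⟨A, hA, hx⟩
    rw [Finset.mem_toList, Finset.mem_filter, Finset.mem_powerset] at hA
    rw [← hA.2]
    exact hfS _ _ ((hiff A hA.1).1 hx)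

/-- A language is constant-depth truth-table reducible to `B` if its words are recognised by a
disjunction, of linear length, of conjunctions of local conditions and of boundedly many oracle
queries with local bits. -/
theorem binCDReducible_of_juntas {K B : Language Bool} (W c : ℕ)
    (h : ∀ n, ∃ Φ : List (List ((Fin n → Bool) → Bool) ×
        List (List ((Fin n → Bool) → Bool) × Bool)), Φ.length ≤ c * (n + 1) ∧
      (∀ φ ∈ Φ, φ.1.length ≤ c * (n + 1) ∧ (∀ f ∈ φ.1, IsJunta W f) ∧ φ.2.length ≤ c ∧
        ∀ ψ ∈ φ.2, ψ.1.length ≤ c * (n + 1) ∧ ∀ f ∈ ψ.1, IsJunta W f) ∧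
      ∀ x : Fin n → Bool, List.ofFn x ∈ K ↔ ∃ φ ∈ Φ, (∀ f ∈ φ.1, f x = true) ∧
        ∀ ψ ∈ φ.2, ((ψ.1.map fun f => f x) ∈ B ↔ ψ.2 = true)) :
    BinCDReducible K B := by
  classical
  -- The cost of a formula whose subformulas are rebuilt at each use. Its depth is 7: three levels
  -- for the local functions, then an oracle gate, a possible negation, a conjunction and a
  -- disjunction.
  let cost : ℕ → ℕ := fun n =>
    c * (n + 1) * ((c * (n + 1) + c) * (c * (n + 1) * juntaCost W + 1 + 1 + juntaCost W) + 1) + 1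
  have hC : ∀ n, ∃ C : Circuit n,
      (∀ x : Fin n → Bool, C.eval B x C.output = true ↔ List.ofFn x ∈ K) ∧
      (∀ i, C.depthAt i ≤ 7) ∧ C.size ≤ cost n ∧
      (∀ i, (C.gate i).IsOracle → (C.gate i).args.length ≤ c * (n + 1)) ∧
      (∀ i j, (C.gate i).IsOracle → (C.gate j).IsOracle → ¬ Relation.TransGen C.Wire i j) := by
    intro n
    obtain ⟨Φ, hΦ, hΦ', hK⟩ := h n
    let Q : List ((Fin n → Bool) → Bool) × Bool → (Fin n → Bool) → Bool := fun ψ x =>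
      if ψ.2 then decide ((ψ.1.map fun f => f x) ∈ B) else !decide ((ψ.1.map fun f => f x) ∈ B)
    let F : List ((Fin n → Bool) → Bool) × List (List ((Fin n → Bool) → Bool) × Bool) →
      (Fin n → Bool) → Bool := fun φ x => (φ.1 ++ φ.2.map Q).all fun f => f x
    have hQ : ∀ φ ∈ Φ, ∀ ψ ∈ φ.2, Buildable B 7 (c * (n + 1)) False 5
        (c * (n + 1) * juntaCost W + 1 + 1) (Q ψ) := by
      intro φ hφ ψ hψ
      obtain ⟨hlen, hj⟩ := (hΦ' φ hφ).2.2.2 ψ hψ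
      have ho := (Buildable.oracle (fun f hf => (hj f hf).buildable B (c * (n + 1))
        (by norm_num : 3 ≤ 7)) (by norm_num) hlen).mono (c' := c * (n + 1) * juntaCost W + 1) id
          le_rfl (Nat.succ_le_succ (Nat.mul_le_mul_right _ hlen))
      by_cases hb : ψ.2 = true
      · simp only [Q, hb, if_true]
        exact ho.mono id (by norm_num) (Nat.le_succ _)
      · simp only [Q, hb]
        exact ho.not (by norm_num)
    have hF : ∀ φ ∈ Φ, Buildable B 7 (c * (n + 1)) False 6
        ((c * (n + 1) + c) * (c * (n + 1) * juntaCost W + 1 + 1 + juntaCost W) + 1) (F φ) := by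
      intro φ hφ
      obtain ⟨h₁, h₂, h₃, -⟩ := hΦ' φ hφ
      refine (Buildable.all (fs := φ.1 ++ φ.2.map Q) (d := 5)
        (c := c * (n + 1) * juntaCost W + 1 + 1 + juntaCost W) (fun f hf => ?_) (by norm_num)).mono
        id le_rfl ?_
      · rcases List.mem_append.1 hf with hf | hf
        · exact ((h₂ f hf).buildable B _ (by norm_num)).mono False.elim (by norm_num)
            (Nat.le_add_left _ _)
        · obtain ⟨ψ, hψ, rfl⟩ := List.mem_map.1 hf
          exact (hQ φ hφ ψ hψ).mono id le_rfl (Nat.le_add_right _ _)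
      · refine Nat.succ_le_succ (Nat.mul_le_mul_right _ ?_)
        simp only [List.length_append, List.length_map]
        omega
    have hO := (Buildable.any (fs := Φ.map F) (D := 7) (d := 6) (fun f hf => by
      obtain ⟨φ, hφ, rfl⟩ := List.mem_map.1 hf
      exact hF φ hφ) (by norm_num)).mono
      (c' := cost n) id le_rfl (Nat.succ_le_succ (Nat.mul_le_mul_right _ (by simpa using hΦ)))
    obtain ⟨C, -, hsize, i, hi, hval, -⟩ := hO .empty
    obtain ⟨C', h₁, h₂, h₃, h₄, h₅⟩ := C.exists_circuit hi
    refine ⟨C', fun x => ?_, h₃, ?_, h₄, h₅⟩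
    · rw [h₂, hval, hK]
      simp only [List.any_map, List.any_eq_true, Function.comp, F, List.all_append, List.all_map,
        Bool.and_eq_true, List.all_eq_true]
      refine exists_congr fun φ => and_congr_right fun _ => and_congr_right fun _ =>
        forall₂_congr fun ψ _ => ?_
      cases hb : ψ.2 <;> simp [Q, hb]
    · rw [h₁]
      simpa [PartialCircuit.empty] using hsize
  choose C hC using hC
  refine ⟨.C c * (.X + 1) * ((.C c * (.X + 1) + .C c) * (.C c * (.X + 1) * .C (juntaCost W) + 1 + 1 +
    .C (juntaCost W)) + 1) + 1, 7, C, fun n => ?_⟩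
  obtain ⟨h₁, h₂, h₃, h₄, h₅⟩ := hC n
  have heval : Polynomial.eval n ((.C c * (.X + 1) * ((.C c * (.X + 1) + .C c) *
      (.C c * (.X + 1) * .C (juntaCost W) + 1 + 1 + .C (juntaCost W)) + 1) + 1 : Polynomial ℕ)) =
      cost n := by
    simp [cost]
  rw [heval]
  refine ⟨h₁, h₂, h₃, fun i hi => (h₄ i hi).trans ?_, h₅⟩
  exact (Nat.le_mul_of_pos_right _ (Nat.succ_pos _)).trans (Nat.le_succ _)

/-! ### Parsing the words of `𝓛_{N,N+1}` locally -/

/-- The lengths of the two blocks. -/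
def lenKL (N : ℕ) (i : Bool) : ℕ := bif i then N + 1 else N

theorem length_blockKL {N : ℕ} (hN : 0 < N) (i : Bool) :
    (blockKL N (N + 1) i).length = lenKL N i := by
  cases i <;> simp [blockKL, lenKL]
  omega

theorem lenKL_pos {N : ℕ} (hN : 0 < N) (i : Bool) : 0 < lenKL N i := by
  cases i <;> simp [lenKL, hN]

theorem lenKL_le (N : ℕ) (i : Bool) : lenKL N i ≤ N + 1 := by
  cases i <;> simp [lenKL]

theorem map_range'_eq_iff {β : Type*} {f : ℕ → β} {s n : ℕ} {l : List β} (hn : n = l.length) :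
    (List.range' s n).map f = l ↔ ∀ o (h : o < n), f (s + o) = l[o] := by
  subst hn
  constructor
  · intro h o ho
    have := List.getElem_of_eq h (i := o) (by simpa using ho)
    simpa using this
  · intro h
    refine List.ext_getElem (by simp) fun o h₁ h₂ => ?_
    simpa using h o h₂

section Parsing

variable (N t : ℕ) (ω : ℕ → Option ABC)

/-- In the prefix of length `t`, a block of kind `i` begins at position `j`. -/
def IsBlockAt (i : Bool) (j : ℕ) : Prop :=
  ω j = some .a ∧ (∀ o, 0 < o → o < lenKL N i → ω (j + o) = some .c) ∧ j + lenKL N i ≤ t ∧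
    (j + lenKL N i = t ∨ ω (j + lenKL N i) = some .a)

/-- The position `p` belongs to a block of kind `i` that begins at position `j`. -/
def Covers (p : ℕ) (ij : Bool × ℕ) : Prop :=
  IsBlockAt N t ω ij.1 ij.2 ∧ ij.2 ≤ p ∧ p < ij.2 + lenKL N ij.1

variable {N t ω}

/-- If one of the blocks began later, its first letter `a` would lie where the other has `c`. With a
common start, the short block is followed by `a` or by the end `t`, where the long one has its last
`c`. -/
theorem Covers.unique {p : ℕ} {ij ij' : Bool × ℕ} (h : Covers N t ω p ij)
    (h' : Covers N t ω p ij') : ij = ij' := by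
  have hle : ∀ {ij ij' : Bool × ℕ}, Covers N t ω p ij → Covers N t ω p ij' → ij'.2 ≤ ij.2 := by
    intro ij ij' h h'
    by_contra! hlt
    have h₁ := h.1.2.1 (ij'.2 - ij.2) (by omega) (by have := h.2.2; have := h'.2.1; omega)
    rw [Nat.add_sub_cancel' hlt.le, h'.1.1] at h₁
    simp at h₁
  obtain ⟨i, j⟩ := ij
  obtain ⟨i', j'⟩ := ij'
  obtain rfl : j = j' := le_antisymm (hle h' h) (hle h h')
  have hfalse : IsBlockAt N t ω false j → IsBlockAt N t ω true j → 0 < N → False := by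
    rintro ⟨-, -, -, h₁⟩ ⟨-, h₂, h₃, -⟩ hN
    have := h₂ N hN (by simp [lenKL])
    simp only [lenKL, cond_true, cond_false] at h₁ h₃
    rcases h₁ with h₁ | h₁
    · omega
    · rw [this] at h₁
      simp at h₁
  have hN : i = false ∨ i' = false → 0 < N := by
    rintro (rfl | rfl)
    · have := h.2
      simp [lenKL] at this
      omega
    · have := h'.2
      simp [lenKL] at this
      omega
  cases i <;> cases i'
  · rfl
  · exact (hfalse h.1 h'.1 (hN (.inl rfl))).elim
  · exact (hfalse h'.1 h.1 (hN (.inr rfl))).elim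
  · rfl

/-- A block through `p` has length at most `N + 1`: it begins at `p - N` or later, and the letter
after it stands at `p + N + 1` or earlier. -/
theorem covers_congr {ω' : ℕ → Option ABC} {p : ℕ}
    (h : ∀ i ∈ Finset.Icc (p - N) (p + (N + 1)), ω i = ω' i) :
    Covers N t ω p = Covers N t ω' p := by
  funext ⟨i, j⟩
  have hlen := lenKL_le N i
  have hj : j ≤ p → p < j + lenKL N i → ∀ o ≤ lenKL N i, ω (j + o) = ω' (j + o) := by
    intro h₁ h₂ o ho
    refine h _ (Finset.mem_Icc.2 ⟨?_, ?_⟩) <;> omega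
  refine propext (and_congr_left fun ⟨h₁, h₂⟩ => ?_)
  have hj := hj h₁ h₂
  unfold IsBlockAt
  rw [show ω j = ω' j from hj 0 (Nat.zero_le _), hj _ le_rfl]
  refine and_congr_right fun _ => and_congr_left fun _ => forall_congr' fun o =>
    forall₂_congr fun _ ho => ?_
  rw [hj o ho.le]

theorem isBlockAt_iff (hN : 0 < N) {i : Bool} {j : ℕ} : IsBlockAt N t ω i j ↔
    (List.range' j (lenKL N i)).map ω = (blockKL N (N + 1) i).map some ∧
      j + lenKL N i ≤ t ∧ (j + lenKL N i = t ∨ ω (j + lenKL N i) = some .a) := by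
  have hpos := lenKL_pos hN i
  have hlen : lenKL N i = ((blockKL N (N + 1) i).map some).length := by
    rw [List.length_map, length_blockKL hN]
  have hmap : (List.range' j (lenKL N i)).map ω = (blockKL N (N + 1) i).map some ↔
      ω j = some .a ∧ ∀ o, 0 < o → o < lenKL N i → ω (j + o) = some .c := by
    rw [map_range'_eq_iff hlen]
    constructor
    · intro h
      refine ⟨by simpa [blockKL] using h 0 hpos, fun o ho ho' => ?_⟩
      obtain ⟨o, rfl⟩ : ∃ o', o = o' + 1 := ⟨o - 1, by omega⟩
      simpa [blockKL] using h _ ho'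
    · rintro ⟨h₁, h₂⟩ o ho
      obtain _ | o := o
      · simpa [blockKL] using h₁
      · simpa [blockKL] using h₂ (o + 1) o.succ_pos ho
  rw [hmap, and_assoc]
  rfl

/-- A block covering an `a` must begin there, because its other letters are `c`. It is followed by
another `a` or by the end, so the decomposition continues. At position 0 the covering block has no
earlier place to begin. -/
theorem exists_blocks_of_covers (hN : 0 < N) (h : ∀ p < t, ∃ ij, Covers N t ω p ij) :
    ∃ I : List Bool, (List.range' 0 t).map ω = (I.flatMap (blockKL N (N + 1))).map some := by
  have key : ∀ d s, s + d = t → (d = 0 ∨ ω s = some .a) →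
      ∃ I : List Bool, (List.range' s d).map ω = (I.flatMap (blockKL N (N + 1))).map some := by
    intro d
    induction d using Nat.strong_induction_on with | _ d ih
    intro s hs hd
    rcases hd with rfl | hd
    · exact ⟨[], rfl⟩
    by_cases hd₀ : d = 0
    · exact ⟨[], by simp [hd₀]⟩
    obtain ⟨⟨i, j⟩, hb, hj, hj'⟩ := h s (by omega)
    simp only at hb hj hj'
    obtain rfl : j = s := by
      by_contra hne
      have := hb.2.1 (s - j) (by omega) (by omega)
      rw [Nat.add_sub_cancel' hj, hd] at this
      simp at this
    have hpos := lenKL_pos hN i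
    rw [isBlockAt_iff hN] at hb
    obtain ⟨h₁, h₂, h₃⟩ := hb
    obtain ⟨I, hI⟩ := ih (d - lenKL N i) (by omega) (j + lenKL N i) (by omega)
      (h₃.imp_left (by omega))
    refine ⟨i :: I, ?_⟩
    have hr : List.range' j d = List.range' j (lenKL N i) ++
        List.range' (j + lenKL N i) (d - lenKL N i) := by
      rw [List.range'_append_1]
      congr 1
      omega
    rw [hr, List.map_append, h₁, hI]
    simp
  refine key t 0 (by omega) ?_
  by_cases ht : t = 0
  · exact .inl ht
  · obtain ⟨⟨i, j⟩, hb, hj, -⟩ := h 0 (by omega)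
    obtain rfl : j = 0 := Nat.le_zero.1 hj
    exact .inr hb.1

/-! ### Replacing each letter by a word of fixed length -/

variable {α : Type*}

open Classical in
/-- The letters replacing position `p`, if each block of kind `i` is replaced by the word `A i`,
each of its positions by `c` letters. -/
noncomputable def blockLetters (c : ℕ) (A : Bool → List α) (p : ℕ) (P : Bool × ℕ → Prop) :
    List α :=
  if h : ∃ ij, P ij then ((A h.choose.1).drop ((p - h.choose.2) * c)).take c else []

theorem flatMap_range_take_drop (l : List α) (c n : ℕ) :
    ((List.range n).flatMap fun o => (l.drop (o * c)).take c) = l.take (n * c) := by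
  induction n with
  | zero => simp
  | succ n ih =>
    rw [List.range_succ, List.flatMap_append, ih, add_mul, one_mul, List.take_add]
    simp

/-- The position at offset `o` in a block contributes the `o`-th slice of width `c` of `A i`, and
these slices concatenate to `A i`. Every position contributes `c` letters whatever its block is; the
ratio N : N+1 of the word lengths serves this purpose. -/
theorem covers_of_blocks (hN : 0 < N) {c : ℕ} {A : Bool → List α}
    (hA : ∀ i, (A i).length = lenKL N i * c) {I : List Bool}
    (hI : (List.range' 0 t).map ω = (I.flatMap (blockKL N (N + 1))).map some) :
    (∀ p < t, ∃ ij, Covers N t ω p ij ∧ (blockLetters c A p (Covers N t ω p)).length = c) ∧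
      (List.range' 0 t).flatMap (fun p => blockLetters c A p (Covers N t ω p)) = I.flatMap A := by
  have hval : ∀ p ij, Covers N t ω p ij →
      blockLetters c A p (Covers N t ω p) = ((A ij.1).drop ((p - ij.2) * c)).take c := by
    intro p ij h
    have hex : ∃ ij, Covers N t ω p ij := ⟨ij, h⟩
    rw [blockLetters, dif_pos hex, hex.choose_spec.unique h]
  have key : ∀ I : List Bool, ∀ s d, s + d = t →
      (List.range' s d).map ω = (I.flatMap (blockKL N (N + 1))).map some →
      (∀ p, s ≤ p → p < t → ∃ ij, Covers N t ω p ij ∧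
        (blockLetters c A p (Covers N t ω p)).length = c) ∧
      (List.range' s d).flatMap (fun p => blockLetters c A p (Covers N t ω p)) = I.flatMap A := by
    intro I
    induction I with
    | nil =>
      intro s d hs h
      obtain rfl : d = 0 := by simpa using congrArg List.length h
      exact ⟨fun p _ _ => by omega, rfl⟩
    | cons i I ih =>
      intro s d hs h
      have hlen := congrArg List.length h
      simp only [List.length_map, List.length_range', List.flatMap_cons, List.length_append,
        length_blockKL hN] at hlen
      obtain ⟨d', rfl⟩ : ∃ d', d = lenKL N i + d' := ⟨_, hlen⟩
      rw [← List.range'_append_1, List.map_append, List.flatMap_cons, List.map_append] at h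
      obtain ⟨h₁, h₂⟩ := List.append_inj h (by simp [length_blockKL hN])
      obtain ⟨ih₁, ih₂⟩ := ih _ _ (by omega) h₂
      have hblock : IsBlockAt N t ω i s := by
        rw [isBlockAt_iff hN]
        refine ⟨h₁, by omega, ?_⟩
        obtain _ | ⟨i', I⟩ := I
        · left
          obtain rfl : d' = 0 := by simpa using congrArg List.length h₂
          omega
        · right
          obtain _ | d' := d'
          · simp [blockKL] at h₂
          · simp only [List.range'_succ, List.map_cons, List.flatMap_cons, blockKL,
              List.cons_append, List.cons.injEq] at h₂
            exact h₂.1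
      have hcov : ∀ p, s ≤ p → p < s + lenKL N i → Covers N t ω p (i, s) :=
        fun p hp hp' => ⟨hblock, hp, hp'⟩
      refine ⟨fun p hp hp' => ?_, ?_⟩
      · by_cases hps : p < s + lenKL N i
        · refine ⟨_, hcov p hp hps, ?_⟩
          rw [hval _ _ (hcov p hp hps), List.length_take, List.length_drop, hA]
          refine min_eq_left ?_
          obtain ⟨o, rfl⟩ := Nat.exists_eq_add_of_le hp
          have : (o + 1) * c ≤ lenKL N i * c := Nat.mul_le_mul_right _ (by omega)
          rw [add_mul, one_mul] at this
          simp only [Nat.add_sub_cancel_left]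
          omega
        · exact ih₁ p (by omega) hp'
      · rw [← List.range'_append_1, List.flatMap_append, ih₂, List.flatMap_cons]
        congr 1
        rw [List.range'_eq_map_range, List.flatMap_map]
        have : ∀ o ∈ List.range (lenKL N i), blockLetters c A (s + o) (Covers N t ω (s + o)) =
            ((A i).drop (o * c)).take c := fun o ho => by
          rw [hval _ _ (hcov (s + o) (by omega) (by have := List.mem_range.1 ho; omega))]
          simp
        rw [List.flatMap_congr this, flatMap_range_take_drop, ← hA, List.take_length]
  obtain ⟨h₁, h₂⟩ := key I 0 t (by omega) hI
  exact ⟨fun p hp => h₁ p (Nat.zero_le _) hp, h₂⟩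

/-- The letters replacing a letter `b₁` or `b₂`. -/
def returnLetters (B : Bool → List α) : Option ABC → List α
  | some .b₁ => B false
  | some .b₂ => B true
  | _ => []

theorem returnLetters_letterKL (B : Bool → List α) (i : Bool) :
    returnLetters B (some (letterKL i)) = B i := by
  cases i <;> rfl

theorem exists_letters {s d : ℕ} (h : ∀ p, s ≤ p → p < s + d → ∃ i, ω p = some (letterKL i)) :
    ∃ J : List Bool, (List.range' s d).map ω = (J.map letterKL).map some := by
  induction d generalizing s with
  | zero => exact ⟨[], rfl⟩
  | succ d ih =>
    obtain ⟨i, hi⟩ := h s le_rfl (by omega)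
    obtain ⟨J, hJ⟩ := ih (s := s + 1) fun p hp hp' => h p (by omega) (by omega)
    exact ⟨i :: J, by simp [List.range'_succ, hi, hJ]⟩

theorem letters_of_map {B : Bool → List α} {s d : ℕ} {J : List Bool}
    (h : (List.range' s d).map ω = (J.map letterKL).map some) :
    (∀ p, s ≤ p → p < s + d → ∃ i, ω p = some (letterKL i)) ∧
      (List.range' s d).flatMap (fun p => returnLetters B (ω p)) = J.flatMap B := by
  induction d generalizing s J with
  | zero =>
    obtain rfl : J = [] := by simpa [eq_comm] using congrArg List.length h
    exact ⟨fun p _ _ => by omega, rfl⟩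
  | succ d ih =>
    obtain _ | ⟨i, J⟩ := J
    · simp at h
    simp only [List.range'_succ, List.map_cons, List.cons.injEq] at h
    obtain ⟨h₁, h₂⟩ := ih h.2
    refine ⟨fun p hp hp' => ?_, ?_⟩
    · rcases hp.eq_or_lt with rfl | hp
      · exact ⟨i, h.1⟩
      · exact h₁ p hp (by omega)
    · rw [List.range'_succ, List.flatMap_cons, h₂, h.1, returnLetters_letterKL]
      rfl

end Parsing

/-! ### Binary encodings -/

namespace BlockCode

variable {α : Type*} (E : BlockCode α)

theorem mul_add_lt {i m r s : ℕ} (hi : i < m) (hr : r < s) : i * s + r < m * s :=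
  calc i * s + r < (i + 1) * s := by
        rw [add_mul, one_mul]
        omega
    _ ≤ m * s := Nat.mul_le_mul_right _ hi

/-- The binary encoding of a word. -/
def enc (w : List α) : List Bool := w.flatMap fun a => (E.block a).toList

theorem length_enc (w : List α) : (E.enc w).length = w.length * E.size := by
  induction w with
  | nil => simp [enc]
  | cons a w ih =>
    have : E.enc (a :: w) = (E.block a).toList ++ E.enc w := rfl
    rw [this, List.length_append, ih, List.Vector.toList_length, List.length_cons]
    ring

theorem enc_append (u v : List α) : E.enc (u ++ v) = E.enc u ++ E.enc v := by
  simp [enc]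

theorem enc_flatMap {ι : Type*} (l : List ι) (f : ι → List α) :
    E.enc (l.flatMap f) = l.flatMap fun i => E.enc (f i) := by
  simp [enc, List.flatMap_assoc]

/-- The `i`-th letter of a word encoded by the bits `x`. -/
noncomputable def letterAt {n : ℕ} (x : Fin n → Bool) (i : ℕ) : Option α :=
  Function.partialInv E.block
    -- Bits beyond the end are read as `false`; no letter of an input made of whole blocks is
    -- affected.
    (List.Vector.ofFn fun r : Fin E.size => if h : i * E.size + r < n then x ⟨_, h⟩ else false)

theorem ofFn_eq_enc_iff {m n : ℕ} (hn : n = m * E.size) (x : Fin n → Bool) (w : List α) :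
    List.ofFn x = E.enc w ↔ (List.range' 0 m).map (E.letterAt x) = w.map some := by
  subst hn
  have hlen : List.ofFn x = E.enc w → w.length = m := fun h => by
    have := congrArg List.length h
    rw [List.length_ofFn, E.length_enc] at this
    exact (Nat.eq_of_mul_eq_mul_right E.size_pos this).symm
  have hlen' : (List.range' 0 m).map (E.letterAt x) = w.map some → w.length = m := fun h => by
    simpa using (congrArg List.length h).symm
  by_cases hw : w.length = m
  swap
  · exact ⟨fun h => absurd (hlen h) hw, fun h => absurd (hlen' h) hw⟩
  subst hw
  have h₁ : List.ofFn x = (List.ofFn fun i : Fin w.length =>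
      (List.ofFn fun r : Fin E.size => x ⟨i * E.size + r, mul_add_lt i.2 r.2⟩)).flatten := List.ofFn_mul x
  have h₂ : E.enc w = (w.map fun a => (E.block a).toList).flatten := by
    rw [enc, List.flatMap_def]
  have h₃ : List.ofFn x = E.enc w ↔ (List.ofFn fun i : Fin w.length =>
      (List.ofFn fun r : Fin E.size => x ⟨i * E.size + r, mul_add_lt i.2 r.2⟩)) =
      (w.map fun a => (E.block a).toList) := by
    rw [h₁, h₂, List.eq_iff_flatten_eq]
    refine (and_iff_left ?_).symm
    refine List.ext_getElem (by simp) fun i _ _ => ?_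
    simp
  have h₄ : ∀ f : ℕ → Option α, (List.range' 0 w.length).map f = w.map some ↔
      ∀ i (hi : i < w.length), f i = some w[i] := fun f => by
    rw [map_range'_eq_iff (by simp)]
    simp
  rw [h₃, h₄]
  have h₅ : ∀ i (hi : i < w.length), E.letterAt x i = some w[i] ↔
      (List.ofFn fun r : Fin E.size => x ⟨i * E.size + r, mul_add_lt hi r.2⟩) = (E.block w[i]).toList := by
    intro i hi
    rw [letterAt, E.injective.isPartialInv, ← List.Vector.toList_injective.eq_iff,
      List.Vector.toList_ofFn, eq_comm]
    have hbound : ∀ r : Fin E.size, i * E.size + r < w.length * E.size := fun r => mul_add_lt hi r.2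
    simp only [hbound, dif_pos]
  constructor
  · intro h i hi
    rw [h₅]
    have := List.getElem_of_eq h (i := i) (by simpa using hi)
    simpa using this
  · intro h
    refine List.ext_getElem (by simp) fun i hi _ => ?_
    have hi' : i < w.length := by simpa using hi
    simpa using (h₅ i hi').1 (h i hi')

theorem enc_injective : Function.Injective E.enc := by
  intro u v h
  have hlen : u.length = v.length := by
    have := congrArg List.length h
    rw [E.length_enc, E.length_enc] at this
    exact Nat.eq_of_mul_eq_mul_right E.size_pos this
  have h₁ : (u.map fun a => (E.block a).toList) = v.map fun a => (E.block a).toList := by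
    rw [List.eq_iff_flatten_eq, ← List.flatMap_def, ← List.flatMap_def]
    refine ⟨h, List.ext_getElem (by simpa using hlen) fun i _ _ => ?_⟩
    simp
  exact List.map_injective_iff.2
    (List.Vector.toList_injective.comp E.injective) h₁

theorem enc_mem_encode_iff {L : Language α} {w : List α} : E.enc w ∈ E.encode L ↔ w ∈ L :=
  ⟨fun ⟨_, hv, h⟩ => E.enc_injective h ▸ hv, fun h => ⟨w, h, rfl⟩⟩

/-- Functions of few letters are local. -/
theorem isJunta_of_letters {n : ℕ} (P : Finset ℕ) {p : ℕ} (hP : P.card ≤ p)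
    {f : (Fin n → Bool) → Bool}
    (hf : ∀ x y, (∀ i ∈ P, E.letterAt x i = E.letterAt y i) → f x = f y) :
    IsJunta (p * E.size) f := by
  classical
  refine ⟨Finset.univ.filter fun j => j.1 / E.size ∈ P, ?_, fun x y h => hf x y fun i hi => ?_⟩
  · have himg : (Finset.univ.filter fun j : Fin n => j.1 / E.size ∈ P).map Fin.valEmbedding ⊆
        (P ×ˢ Finset.range E.size).image fun ir => ir.1 * E.size + ir.2 := by
      intro j hj
      simp only [Finset.mem_map, Finset.mem_filter, Finset.mem_univ, true_and] at hj
      obtain ⟨j, hj, rfl⟩ := hj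
      refine Finset.mem_image.2 ⟨(j.1 / E.size, j.1 % E.size), ?_, Nat.div_add_mod' _ _⟩
      exact Finset.mem_product.2 ⟨hj, Finset.mem_range.2 (Nat.mod_lt _ E.size_pos)⟩
    rw [← Finset.card_map Fin.valEmbedding]
    refine (Finset.card_le_card himg).trans (Finset.card_image_le.trans ?_)
    rw [Finset.card_product, Finset.card_range]
    exact Nat.mul_le_mul_right _ hP
  · unfold letterAt
    congr 2
    funext r
    split
    · refine h _ ?_
      rw [Finset.mem_filter]
      refine ⟨Finset.mem_univ _, ?_⟩
      change (i * E.size + r) / E.size ∈ P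
      rwa [mul_comm, Nat.mul_add_div E.size_pos, Nat.div_eq_of_lt r.2, add_zero]
    · rfl

end BlockCode

/-! ### The reduction -/

/-- The first `l` bits of a word of bits, as functions. -/
def bitFns {n : ℕ} (l : ℕ) (g : (Fin n → Bool) → List Bool) : List ((Fin n → Bool) → Bool) :=
  -- In the queries, the default pads words that are too short. This occurs only if a local
  -- condition fails, and then the answer of the query does not matter.
  (List.range l).map fun r x => (g x).getD r false

theorem length_bitFns {n : ℕ} (l : ℕ) (g : (Fin n → Bool) → List Bool) :
    (bitFns l g).length = l := by
  simp [bitFns]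

theorem map_bitFns {n l : ℕ} {g : (Fin n → Bool) → List Bool} {x : Fin n → Bool}
    (h : (g x).length = l) : (bitFns l g).map (fun f => f x) = g x := by
  subst h
  rw [bitFns, List.map_map]
  refine List.ext_getElem (by simp) fun r h₁ h₂ => ?_
  simp [List.getElem?_eq_getElem h₂]

section Reduction

variable {α : Type*} (N c q : ℕ) (A B : Bool → List α) (E : BlockCode ABC) (E' : BlockCode α)

/-- The bits of the query for the test words `s`, `u`, `v`, for words of length `m` over `ABC`
whose first part has length `t`. -/
noncomputable def query (n m t : ℕ) (s u v : List α) : List ((Fin n → Bool) → Bool) :=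
  bitFns (E'.enc s).length (fun _ => E'.enc s) ++
    (List.range' 0 t).flatMap (fun p => bitFns (c * E'.size) fun x =>
      E'.enc (blockLetters c A p (Covers N t (E.letterAt x) p))) ++
    bitFns (E'.enc u).length (fun _ => E'.enc u) ++
    (List.range' t (m - t)).flatMap (fun p => bitFns (q * E'.size) fun x =>
      E'.enc (returnLetters B (E.letterAt x p))) ++
    bitFns (E'.enc v).length (fun _ => E'.enc v)

open Classical in
/-- The local conditions for words of length `m` over `ABC` whose first part has length `t`. -/
noncomputable def conditions (n m t : ℕ) : List ((Fin n → Bool) → Bool) :=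
  (List.range' 0 t).map (fun p x => decide (∃ ij, Covers N t (E.letterAt x) p ij)) ++
    (List.range' t (m - t)).map fun p x => decide (∃ i, E.letterAt x p = some (letterKL i))

variable {N c q A B E E'}

theorem map_query {n m t : ℕ} {s u v : List α} {x : Fin n → Bool}
    (hU : ∀ p < t, (blockLetters c A p (Covers N t (E.letterAt x) p)).length = c)
    (hV : ∀ p, t ≤ p → p < t + (m - t) → (returnLetters B (E.letterAt x p)).length = q) :
    (query N c q A B E E' n m t s u v).map (fun f => f x) = E'.enc (s ++
      (List.range' 0 t).flatMap (fun p => blockLetters c A p (Covers N t (E.letterAt x) p)) ++ u ++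
      (List.range' t (m - t)).flatMap (fun p => returnLetters B (E.letterAt x p)) ++ v) := by
  simp only [query, List.map_append, List.map_flatMap, E'.enc_append, E'.enc_flatMap]
  rw [map_bitFns (g := fun _ => E'.enc s) rfl, map_bitFns (g := fun _ => E'.enc u) rfl,
    map_bitFns (g := fun _ => E'.enc v) rfl]
  rw [List.flatMap_congr fun p hp => map_bitFns ?_, List.flatMap_congr fun p hp => map_bitFns ?_]
  · have hp := List.mem_range'_1.1 hp
    rw [E'.length_enc, hV p hp.1 hp.2]
  · rw [E'.length_enc, hU p (by simpa using hp)]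

theorem length_query {n m t : ℕ} {s u v : List α} :
    (query N c q A B E E' n m t s u v).length =
      (E'.enc s).length + (E'.enc u).length + (E'.enc v).length + t * (c * E'.size) +
        (m - t) * (q * E'.size) := by
  simp only [query, List.length_append, length_bitFns, List.length_flatMap, List.map_const',
    List.length_range', List.sum_replicate, smul_eq_mul]
  ring

theorem isJunta_const {n W : ℕ} (b : Bool) : IsJunta W fun _ : Fin n → Bool => b :=
  ⟨∅, by simp, fun _ _ _ => rfl⟩

theorem isJunta_covers {n t p : ℕ} {β : Type*} (F : (Bool × ℕ → Prop) → β) (G : β → Bool) :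
    IsJunta ((2 * N + 2) * E.size) fun x : Fin n → Bool =>
      G (F (Covers N t (E.letterAt x) p)) := by
  refine E.isJunta_of_letters (Finset.Icc (p - N) (p + (N + 1))) ?_ fun x y h => ?_
  · rw [Nat.card_Icc]
    omega
  · rw [covers_congr h]

theorem isJunta_letterAt {n p : ℕ} (G : Option ABC → Bool) :
    IsJunta ((2 * N + 2) * E.size) fun x : Fin n → Bool => G (E.letterAt x p) :=
  E.isJunta_of_letters {p} (by simp) fun x y h => by rw [h p (by simp)]

theorem isJunta_of_mem_query {n m t : ℕ} {s u v : List α} :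
    ∀ f ∈ query N c q A B E E' n m t s u v, IsJunta ((2 * N + 2) * E.size) f := by
  intro f hf
  simp only [query, bitFns, List.mem_append, List.mem_map, List.mem_flatMap] at hf
  rcases hf with (((⟨_, -, rfl⟩ | ⟨p, -, r, -, rfl⟩) | ⟨_, -, rfl⟩) | ⟨p, -, r, -, rfl⟩) |
    ⟨_, -, rfl⟩
  · exact isJunta_const _
  · exact isJunta_covers (fun P => E'.enc (blockLetters c A p P)) fun w => w.getD r false
  · exact isJunta_const _
  · exact isJunta_letterAt fun a => (E'.enc (returnLetters B a)).getD r false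
  · exact isJunta_const _

theorem isJunta_of_mem_conditions {n m t : ℕ} :
    ∀ f ∈ conditions N E n m t, IsJunta ((2 * N + 2) * E.size) f := by
  classical
  intro f hf
  simp only [conditions, List.mem_append, List.mem_map] at hf
  rcases hf with ⟨p, -, rfl⟩ | ⟨p, -, rfl⟩
  · exact isJunta_covers (fun P => decide (∃ ij, P ij)) id
  · exact isJunta_letterAt fun a => decide (∃ i, a = some (letterKL i))

theorem forall_conditions_iff {n m t : ℕ} {x : Fin n → Bool} :
    (∀ f ∈ conditions N E n m t, f x = true) ↔
      (∀ p < t, ∃ ij, Covers N t (E.letterAt x) p ij) ∧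
      ∀ p, t ≤ p → p < t + (m - t) → ∃ i, E.letterAt x p = some (letterKL i) := by
  simp only [conditions, List.forall_mem_append, List.forall_mem_map, decide_eq_true_iff,
    List.mem_range'_1, zero_add, Nat.zero_le, true_and, and_imp]

/-- The disjunction runs over the boundary `t` between the blocks and the letters b₁, b₂. The local
conditions say that the two parts come from sequences `I` and `J`, and the queries, made by
letterwise substitution, decide whether `I = J`. The length of a query depends only on `m`, `t` and
the test, not on the input bits. -/
theorem cdReducible_of_block_tests [Finite α] {L : Language α} (hN : 0 < N)
    {T : List (List α × List α × List α × Bool)} (hA : ∀ i, (A i).length = lenKL N i * c)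
    (hB : ∀ i, (B i).length = q)
    (hT : ∀ I J : List Bool, I = J ↔ ∀ t ∈ T,
      (t.1 ++ I.flatMap A ++ t.2.1 ++ J.reverse.flatMap B ++ t.2.2.1 ∈ L ↔ t.2.2.2 = true)) :
    CDReducible (langKL N (N + 1)) L := by
  intro E E'
  let S : ℕ := (T.map fun τ => (E'.enc τ.1).length + (E'.enc τ.2.1).length +
    (E'.enc τ.2.2.1).length).sum
  let C : ℕ := 1 + T.length + S + c * E'.size + q * E'.size
  have hC : 1 ≤ C := by omega
  refine binCDReducible_of_juntas ((2 * N + 2) * E.size) C fun n => ?_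
  by_cases hn : ∃ m, n = m * E.size
  swap
  -- No word has an encoding of this length, so the empty disjunction is correct.
  · refine ⟨[], by simp, by simp, fun x => ?_⟩
    simp only [List.not_mem_nil, false_and, exists_false, iff_false]
    rintro ⟨w, -, hw⟩
    have := congrArg List.length hw
    rw [List.length_ofFn] at this
    exact hn ⟨w.length, this.trans (E.length_enc w)⟩
  obtain ⟨m, hm⟩ := hn
  have hmn : m ≤ n := hm ▸ Nat.le_mul_of_pos_right m E.size_pos
  have hCn : n + 1 ≤ C * (n + 1) := Nat.le_mul_of_pos_left _ hC
  refine ⟨(List.range (m + 1)).map fun t => (conditions N E n m t, T.map fun τ =>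
    (query N c q A B E E' n m t τ.1 τ.2.1 τ.2.2.1, τ.2.2.2)), ?_, ?_, fun x => ?_⟩
  · rw [List.length_map, List.length_range]
    omega
  · simp only [List.forall_mem_map]
    intro t ht
    have ht : t ≤ m := Nat.lt_succ_iff.1 (List.mem_range.1 ht)
    refine ⟨?_, isJunta_of_mem_conditions, by simp; omega, fun τ hτ => ⟨?_, isJunta_of_mem_query⟩⟩
    · simp only [conditions, List.length_append, List.length_map, List.length_range']
      omega
    · rw [length_query]
      have h₁ : (E'.enc τ.1).length + (E'.enc τ.2.1).length + (E'.enc τ.2.2.1).length ≤ S :=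
        List.le_sum_of_mem (List.mem_map_of_mem
          (f := fun τ => (E'.enc τ.1).length + (E'.enc τ.2.1).length + (E'.enc τ.2.2.1).length) hτ)
      have h₂ : t * (c * E'.size) ≤ n * (c * E'.size) := Nat.mul_le_mul_right _ (by omega)
      have h₃ : (m - t) * (q * E'.size) ≤ n * (q * E'.size) := Nat.mul_le_mul_right _ (by omega)
      have h₄ : n * (c * E'.size + q * E'.size) ≤ n * C := Nat.mul_le_mul_left _ (by omega)
      rw [mul_add] at h₄
      have h₅ : C * (n + 1) = n * C + C := by ring
      omega
  have hmem : List.ofFn x ∈ E.encode (langKL N (N + 1)) ↔ ∃ I : List Bool,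
      (List.range' 0 m).map (E.letterAt x) =
        (I.flatMap (blockKL N (N + 1)) ++ I.reverse.map letterKL).map some := by
    constructor
    · rintro ⟨w, hw, hx⟩
      obtain ⟨I, rfl⟩ := mem_langKL_iff.1 hw
      exact ⟨I, (E.ofFn_eq_enc_iff hm x _).1 hx⟩
    · rintro ⟨I, hI⟩
      exact ⟨_, mem_langKL_iff.2 ⟨I, rfl⟩, (E.ofFn_eq_enc_iff hm x _).2 hI⟩
  have hqueries : ∀ t (I J : List Bool),
      (List.range' 0 t).map (E.letterAt x) = (I.flatMap (blockKL N (N + 1))).map some →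
      (List.range' t (m - t)).map (E.letterAt x) = (J.reverse.map letterKL).map some →
      ((∀ ψ ∈ T.map fun τ => (query N c q A B E E' n m t τ.1 τ.2.1 τ.2.2.1, τ.2.2.2),
        ((ψ.1.map fun f => f x) ∈ E'.encode L ↔ ψ.2 = true)) ↔ I = J) := by
    intro t I J hI hJ
    obtain ⟨h₁, h₂⟩ := covers_of_blocks hN hA hI
    obtain ⟨h₃, h₄⟩ := letters_of_map (B := B) hJ
    rw [hT, List.forall_mem_map]
    refine forall₂_congr fun τ _ => ?_
    rw [map_query (fun p hp => (h₁ p hp).choose_spec.2), h₂, h₄, E'.enc_mem_encode_iff]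
    intro p hp hp'
    obtain ⟨i, hi⟩ := h₃ p hp hp'
    rw [hi, returnLetters_letterKL, hB]
  rw [hmem]
  constructor
  · rintro ⟨I, hI⟩
    have hlen := congrArg List.length hI
    simp only [List.length_map, List.length_range', List.length_append] at hlen
    have ht : (I.flatMap (blockKL N (N + 1))).length ≤ m := by omega
    have hsplit : List.range' 0 m = List.range' 0 (I.flatMap (blockKL N (N + 1))).length ++
        List.range' (I.flatMap (blockKL N (N + 1))).length
          (m - (I.flatMap (blockKL N (N + 1))).length) := by
      have := List.range'_append_1 (s := 0) (m := (I.flatMap (blockKL N (N + 1))).length)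
        (n := m - (I.flatMap (blockKL N (N + 1))).length)
      rw [zero_add, Nat.add_sub_cancel' ht] at this
      exact this.symm
    rw [hsplit, List.map_append, List.map_append] at hI
    obtain ⟨h₁, h₂⟩ := List.append_inj hI (by simp)
    refine ⟨_, List.mem_map_of_mem (List.mem_range.2 (Nat.lt_succ_of_le ht)),
      forall_conditions_iff.2 ⟨fun p hp => ?_, (letters_of_map (B := B) h₂).1⟩,
      (hqueries _ I I h₁ h₂).2 rfl⟩
    obtain ⟨ij, h, -⟩ := (covers_of_blocks hN hA h₁).1 p hp
    exact ⟨ij, h⟩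
  · rintro ⟨φ, hφ, h₁₂, h₃⟩
    obtain ⟨t, ht, rfl⟩ := List.mem_map.1 hφ
    rw [List.mem_range] at ht
    obtain ⟨h₁, h₂⟩ := forall_conditions_iff.1 h₁₂
    obtain ⟨I, hI⟩ := exists_blocks_of_covers hN h₁
    obtain ⟨J, hJ⟩ := exists_letters h₂
    rw [← J.reverse_reverse] at hJ
    obtain rfl := (hqueries t I J.reverse hI hJ).1 h₃
    refine ⟨J.reverse, ?_⟩
    have hsplit := List.range'_append_1 (s := 0) (m := t) (n := m - t)
    rw [zero_add, Nat.add_sub_cancel' (Nat.lt_succ_iff.1 ht)] at hsplit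
    rw [← hsplit, List.map_append, List.map_append, hI, hJ]

end Reduction

/-! ### The parameters -/

/-- A bound for the lengths of short words, for `n` states and `g` stack symbols. -/
def wordBound (n g : ℕ) : ℕ := 4 ^ (n ^ (n * g) + 1)

/-- A bound for the lengths of short contexts, for `n` states and `g` stack symbols. -/
def contextBound (n g : ℕ) : ℕ :=
  wordBound n g + 2 * (n ^ (n * g)) ^ (n ^ (n * g)) * (wordBound n g + 1)

/-- The computed parameter, for `n` states and `g` stack symbols. -/
def slopeBound (n g : ℕ) : ℕ := 9 * contextBound n g ^ 4 + 1

theorem primrec_pow : Primrec₂ fun a b : ℕ => a ^ b :=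
  Primrec₂.unpaired'.1 Nat.Primrec.pow

theorem primrec_slopeBound : Primrec₂ slopeBound := by
  have hR : Primrec fun p : ℕ × ℕ => p.1 ^ (p.1 * p.2) :=
    primrec_pow.comp .fst (Primrec.nat_mul.comp .fst .snd)
  have hw : Primrec fun p : ℕ × ℕ => wordBound p.1 p.2 :=
    primrec_pow.comp (.const 4) (Primrec.nat_add.comp hR (.const 1))
  have hc : Primrec fun p : ℕ × ℕ => contextBound p.1 p.2 :=
    Primrec.nat_add.comp hw (Primrec.nat_mul.comp
      (Primrec.nat_mul.comp (.const 2) (primrec_pow.comp hR hR))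
      (Primrec.nat_add.comp hw (.const 1)))
  exact Primrec.nat_add.comp (Primrec.nat_mul.comp (.const 9) (primrec_pow.comp hc (.const 4)))
    (.const 1)

theorem cdReducible_slopeBound {α : Type*} [Finite α] {kind : α → LetterKind} {n g : ℕ}
    (A : DVPA kind (Fin n) (Fin g)) (hweak : IsWeaklyLengthSynchronous kind A.language)
    (hnot : ¬ IsLengthSynchronous kind A.language) :
    CDReducible (langKL (slopeBound n g) (slopeBound n g + 1)) A.language := by
  obtain ⟨hfin, hcard⟩ := finite_synMonoid_of_dvpa A
  obtain ⟨hfin', hcard'⟩ := card_synOps_le (kind := kind) (L := A.language)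
  simp only [Nat.card_fin] at hcard
  have hpos : 0 < Nat.card (SynMonoid kind A.language) :=
    have : Nonempty (SynMonoid kind A.language) := ⟨1⟩
    Nat.card_pos
  obtain ⟨e, σ, τ, he, hr, hσ, hτ, hσpos, hτpos, hσB, hτB, hne⟩ :=
    exists_short_witnesses hweak hnot rfl rfl
  have hword : 4 ^ (Nat.card (SynMonoid kind A.language) + 1) ≤ wordBound n g :=
    Nat.pow_le_pow_right (by norm_num) (by omega)
  have hops : Nat.card (SynOps kind A.language) ≤ (n ^ (n * g)) ^ (n ^ (n * g)) :=
    hcard'.trans ((Nat.pow_le_pow_left hcard _).trans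
      (Nat.pow_le_pow_right (hpos.trans_le hcard) hcard))
  have hB : 4 ^ (Nat.card (SynMonoid kind A.language) + 1) +
      2 * Nat.card (SynOps kind A.language) *
        (4 ^ (Nat.card (SynMonoid kind A.language) + 1) + 1) ≤ contextBound n g :=
    Nat.add_le_add hword (Nat.mul_le_mul (Nat.mul_le_mul_left _ hops) (by omega))
  obtain ⟨D, hD⟩ := exists_blockPair he hσ hτ hσpos hτpos ⟨hσB.1.trans hB, hσB.2.trans hB⟩
    ⟨hτB.1.trans hB, hτB.2.trans hB⟩ hne
  -- The constant in `slopeBound` is (3B²)² = 9B⁴, for blocks with components of length at most 3B²;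
  -- the added 1 makes it positive.
  have hDN : (D.block false).1.1.length * (D.block true).1.2.length ≤ slopeBound n g := by
    refine (Nat.mul_le_mul (hD false).1 (hD true).2).trans (le_trans (le_of_eq ?_) (Nat.le_succ _))
    ring
  obtain ⟨c, q, U, V, T, hU₁, hU₂, hV, hT⟩ := exists_block_tests
    (fun w hw => A.wellMatched_of_mem_language hw) hweak he hr D (N := slopeBound n g)
      (Nat.succ_pos _) hDN
  refine cdReducible_of_block_tests (c := c) (Nat.succ_pos _) (fun i => ?_) hV hT
  cases i
  · exact hU₁
  · exact hU₂

end VP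

theorem mainTheorem5 :
    ∃ f : VP.DVPACode →. ℕ × ℕ, Partrec f ∧
      ∀ (s n g : ℕ) (kind : Fin s → VP.LetterKind) (A : VP.DVPA kind (Fin n) (Fin g)),
        VP.IsWeaklyLengthSynchronous kind A.language →
        ¬ VP.IsLengthSynchronous kind A.language →
        ∃ k l : ℕ, (k, l) ∈ f A.code ∧ 0 < k ∧ 0 < l ∧ k ≠ l ∧
          VP.CDReducible (VP.langKL k l) A.language := by
  -- The output depends only on the numbers of states and stack symbols, so the function is total
  -- and primitive recursive. The synchronicity hypotheses are needed only for the correctness of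
  -- the output.
  let N : VP.DVPACode → ℕ := fun code => VP.slopeBound code.1.2.1 code.1.2.2
  have hN : Primrec N := VP.primrec_slopeBound.comp
    (Primrec.fst.comp (Primrec.snd.comp Primrec.fst))
    (Primrec.snd.comp (Primrec.snd.comp Primrec.fst))
  refine ⟨fun code => Part.some (N code, N code + 1),
    (hN.pair (Primrec.succ.comp hN)).to_comp, fun s n g kind A hweak hnot => ?_⟩
  exact ⟨VP.slopeBound n g, VP.slopeBound n g + 1, Part.mem_some _, Nat.succ_pos _, Nat.succ_pos _,
    (Nat.succ_ne_self _).symm, VP.cdReducible_slopeBound A hweak hnot⟩
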